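/- Let $J_\nu$ be the Bessel function of the first kind, $C_k^{(\lambda)}$ the Gegenbauer polynomials, $\operatorname{erf}(w)=\frac{2}{\sqrt\pi}\int_0^w e^{-t^2}\,dt$ and $\operatorname{erfc}(w)=1-\operatorname{erf}(w)$ for $w\in\mathbb C$. For $z>0$, $\xi\in[-1,1]$ and small real $\lambda\neq 0$ let $$K^{(\lambda)}_4(z,\xi)=4^{\lambda/2}\,\Gamma\Big(\frac{2\lambda+4}{4}\Big)\sum_{k=0}^\infty e^{-\frac{i\pi k}{4}}\,\frac{\lambda+k}{\lambda}\,z^{-\lambda}J_{\frac{k+\lambda}{2}}\Big(\frac{z^2}{2}\Big)C_k^{(\lambda)}(\xi)$$ (the radially deformed Fourier kernel with parameter $a=4$ in dimension $m=2\lambda+2$, where $z=|x||y|$ and $\xi=\langle x,y\rangle/z$). For $z\ge 0$ and $\xi=\cos\theta\in[-1,1]$ let the two-dimensional kernel be $$K_4^2(z,\xi)=J_0\Big(\frac{z^2}{2}\Big)+2\sum_{k=1}^\infty e^{-\frac{i\pi k}{4}}J_{\frac k2}\Big(\frac{z^2}{2}\Big)\cos k\theta .$$ The latter series converges absolutely;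 for $z>0$ the series of $K_4^{(\lambda)}(z,\xi)$ converges absolutely for all sufficiently small $\lambda\ne0$, and $\lim_{\lambda\to 0}K_4^{(\lambda)}(z,\xi)=K_4^2(z,\xi)$. Moreover, for all $z\ge 0$ and $\xi=\cos\theta\in[-1,1]$, $$K_4^2(z,\xi)=e^{-iz^2(\xi^2-1/2)}\operatorname{erfc}\big(-e^{-i\pi/4}z\xi\big)=(1-i)\Big(\frac2\pi\Big)^{1/2}e^{-\frac i2 z^2\cos2\theta}\int_{-\infty}^{z\cos\theta}e^{it^2}\,dt,$$ where the last integral is the convergent improper integral $\lim_{s\to-\infty}\int_s^{z\cos\theta}e^{it^2}\,dt$. Furthermore, $$|K_4^2(z,\xi)|\le 1+2\sqrt{\frac2\pi}\qquad\text{for all } z\ge 0,\ \xi\in[-1,1],$$ and $\lim_{z\to+\infty}|K_4^2(z,1)|=2$. -/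

import Mathlib

open Filter Topology

noncomputable section

namespace RadialFourier

/-- Bessel function of the first kind `J_ν(x)` of real order `ν`, for `x > 0` (and for `x = 0`
when `ν ≥ 0`), by its power series. `(Real.Gamma s)⁻¹ = 0` at the poles `s = 0, -1, -2, …`, which is
the usual value of the entire function `1 / Γ`. -/
def besselJ (ν x : ℝ) : ℝ :=
  ∑' n : ℕ, (-1 : ℝ) ^ n / (n.factorial : ℝ) * (Real.Gamma ((n : ℝ) + ν + 1))⁻¹ *
    (x / 2) ^ (2 * (n : ℝ) + ν)

/-- Gegenbauer (ultraspherical) polynomial `C_k^{(l)}(ξ)`. -/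
def gegenbauer (l : ℝ) (k : ℕ) (ξ : ℝ) : ℝ :=
  ∑ j ∈ Finset.range (k / 2 + 1),
    (-1 : ℝ) ^ j * (ascPochhammer ℝ (k - j)).eval l /
      ((j.factorial : ℝ) * ((k - 2 * j).factorial : ℝ)) * (2 * ξ) ^ (k - 2 * j)

/-- The error function on `ℂ`: the integral of `(2 / √π) exp (-t ^ 2)` along the segment
`t = s w`, `0 ≤ s ≤ 1`, from `0` to `w`. -/
def erf (w : ℂ) : ℂ :=
  2 / (Real.sqrt Real.pi : ℂ) * ∫ s in (0 : ℝ)..1, Complex.exp (-((s : ℂ) * w) ^ 2) * w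

/-- The complementary error function on `ℂ`. -/
def erfc (w : ℂ) : ℂ := 1 - erf w

/-- The `k`-th term of the series for the radially deformed Fourier kernel, where
`l = (m - 2) / 2 ≠ 0` is the parameter belonging to the dimension `m`. -/
def kernelTerm (a l z ξ : ℝ) (k : ℕ) : ℂ :=
  Complex.exp (-(Complex.I * (Real.pi : ℂ) * (k : ℂ) / (a : ℂ))) *
    (((l + (k : ℝ)) / l * z ^ (-l) *
      besselJ (2 * ((k : ℝ) + l) / a) (2 / a * z ^ (a / 2)) * gegenbauer l k ξ : ℝ) : ℂ)

/-- The radially deformed Fourier kernel `K_a^m(z, ξ)`, for `l = (m - 2) / 2 ≠ 0`,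
where `z = |x||y| > 0` and `ξ = ⟨x, y⟩ / z`. -/
def kernel (a l z ξ : ℝ) : ℂ :=
  ((a ^ (2 * l / a) * Real.Gamma ((2 * l + a) / a) : ℝ) : ℂ) * ∑' k : ℕ, kernelTerm a l z ξ k

/-- The `k`-th term (`k ≥ 1`) of the series for the two-dimensional kernel, without the factor `2`;
`θ = arccos ξ`. -/
def planarTerm (a z ξ : ℝ) (k : ℕ) : ℂ :=
  Complex.exp (-(Complex.I * (Real.pi : ℂ) * (k : ℂ) / (a : ℂ))) *
    ((besselJ (2 * (k : ℝ) / a) (2 / a * z ^ (a / 2)) *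
      Real.cos ((k : ℝ) * Real.arccos ξ) : ℝ) : ℂ)

/-- The two-dimensional radially deformed Fourier kernel `K_a^2(z, ξ)`:
`J_0(z_a) + 2 ∑_{k ≥ 1} e^{-iπk/a} J_{2k/a}(z_a) cos (kθ)`, with `z_a = (2 / a) z^{a / 2}` and
`ξ = cos θ`. -/
def planarKernel (a z ξ : ℝ) : ℂ :=
  ((besselJ 0 (2 / a * z ^ (a / 2)) : ℝ) : ℂ) + 2 * ∑' k : ℕ, planarTerm a z ξ (k + 1)

end RadialFourier

end

noncomputable section

namespace RadialFourier

/-! ### Gegenbauer polynomials near `l = 0` -/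

/-! Put `rho` $=\rho=e^{-i\pi/4}/2$. Since $16\rho^4=-1$, expanding each Bessel function turns the
planar kernel into an absolutely convergent double series in $(\rho z)^{4n+k}$, and collecting
$N=4n+k$ gives a power series in $z$ (`planarKernel_eq_tsum_planarCoeff`). Pascal's rule for
$1/(n!\,\Gamma(x-n+1))$ and the addition formula for cosine give a two-step recurrence for its
coefficients, with an inhomogeneous term only from odd to odd degree (`planarCoeff_recurrence`). The
recurrence says that $K'=-iz\cos(2\theta)K+\frac{4\rho}{\sqrt\pi}\cos\theta\,e^{iz^2/2}$ with
$K(0)=1$. The integrating factor $e^{iz^2\cos(2\theta)/2}$ solves this by a Fresnel integral $F$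
(`planarSeries_eq`): up to a unimodular factor, $K=1+\frac{4\rho}{\sqrt\pi}F(z\cos\theta)$. Both
closed forms follow, because $\operatorname{erf}$ on the line through $\rho$ is $F$ and because
$\frac{4\rho}{\sqrt\pi}F(\infty)=1$. The last identity also gives the limit $2$ at $\xi=1$, and
$|F|\le\sqrt2$ gives the uniform bound.

The limit $\lambda\to0$ is dominated convergence. The pole $1/\lambda$ cancels against the
Pochhammer symbol, the weighted Gegenbauer polynomials grow at most like $16^k$, and the Bessel
factors decay faster than any geometric sequence (`exists_norm_kernelTerm_le`). -/

theorem chebyshevU_eval_eq_sum (x : ℝ) (k : ℕ) :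
    (Polynomial.Chebyshev.U ℝ k).eval x =
      ∑ j ∈ Finset.range (k + 1), (-1 : ℝ) ^ j * ((k - j).choose j : ℝ) * (2 * x) ^ (k - 2 * j) := by
  induction k using Nat.twoStepInduction with
  | zero => simp
  | one => simp [Finset.sum_range_succ]
  | more k ih0 ih1 =>
    have hU := congrArg (Polynomial.eval x) (Polynomial.Chebyshev.U_add_two ℝ (k : ℤ))
    simp only [Polynomial.eval_sub, Polynomial.eval_mul, Polynomial.eval_X,
      Polynomial.eval_ofNat] at hU
    push_cast at ih1 ⊢
    rw [hU, ih0, ih1, Finset.sum_range_succ _ (k + 1 + 1), Finset.sum_range_succ' _ (k + 1),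
      Finset.sum_range_succ' _ (k + 1)]
    have hterm : ∀ j ∈ Finset.range (k + 1),
        (-1 : ℝ) ^ (j + 1) * ((k + 1 + 1 - (j + 1)).choose (j + 1) : ℝ) *
          (2 * x) ^ (k + 1 + 1 - 2 * (j + 1)) =
        2 * x * ((-1 : ℝ) ^ (j + 1) * ((k + 1 - (j + 1)).choose (j + 1) : ℝ) *
          (2 * x) ^ (k + 1 - 2 * (j + 1))) -
        (-1 : ℝ) ^ j * ((k - j).choose j : ℝ) * (2 * x) ^ (k - 2 * j) := by
      intro j hj
      have hj' : j ≤ k := by simpa [Nat.lt_succ_iff] using hj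
      have h1 : k + 1 + 1 - (j + 1) = (k - j) + 1 := by omega
      have h2 : k + 1 - (j + 1) = k - j := by omega
      have h3 : k + 1 + 1 - 2 * (j + 1) = k - 2 * j := by omega
      rw [h1, h2, h3, Nat.choose_succ_succ]
      push_cast
      -- For $2j\ge k$ the truncated exponent is wrong, but it is multiplied by a vanishing binomial
      -- coefficient.
      rcases Nat.lt_or_ge (2 * j) k with h | h
      · have h4 : k - 2 * j = (k + 1 - 2 * (j + 1)) + 1 := by omega
        rw [h4, pow_succ, pow_succ]; ring
      · rw [Nat.choose_eq_zero_of_lt (show k - j < j + 1 by omega), pow_succ]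
        push_cast; ring
    rw [Finset.sum_congr rfl hterm, Finset.sum_sub_distrib, ← Finset.mul_sum,
      Nat.choose_eq_zero_of_lt (show k + 1 + 1 - (k + 1 + 1) < k + 1 + 1 by omega)]
    have h5 : k + 1 + 1 - 2 * 0 = (k + 1 - 2 * 0) + 1 := by omega
    rw [h5, pow_succ]
    simp
    ring

theorem factorial_ratio_eq_choose_add_choose {k j : ℕ} (hj : 2 * (j + 1) ≤ k) :
    (k : ℝ) * ((k - (j + 1) - 1).factorial : ℝ) /
        (((j + 1).factorial : ℝ) * ((k - 2 * (j + 1)).factorial : ℝ)) =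
      ((k - (j + 1)).choose (j + 1) : ℝ) + ((k - 2 - j).choose j : ℝ) := by
  obtain ⟨m, rfl⟩ := Nat.exists_eq_add_of_le hj
  have h1 : 2 * (j + 1) + m - (j + 1) - 1 = m + j := by omega
  have h2 : 2 * (j + 1) + m - 2 * (j + 1) = m := by omega
  have h3 : 2 * (j + 1) + m - (j + 1) = m + (j + 1) := by omega
  have h4 : 2 * (j + 1) + m - 2 - j = m + j := by omega
  rw [h1, h2, h3, h4, ← Nat.choose_symm_add, ← Nat.choose_symm_add, Nat.cast_add_choose,
    Nat.cast_add_choose, show m + (j + 1) = (m + j) + 1 by ring, Nat.factorial_succ,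
    Nat.factorial_succ]
  have : ((j.factorial : ℕ) : ℝ) ≠ 0 := by positivity
  have : ((m.factorial : ℕ) : ℝ) ≠ 0 := by positivity
  push_cast
  field_simp
  ring

/-- Compares coefficients in $2T_k=U_k-U_{k-2}$. The left side is the value at $l=0$ of the right
side of `ratio_mul_gegenbauer`. -/
theorem sum_factorial_ratio_eq_chebyshevT (x : ℝ) {k : ℕ} (hk : 1 ≤ k) :
    (k : ℝ) * ∑ j ∈ Finset.range (k / 2 + 1), (-1 : ℝ) ^ j * ((k - j - 1).factorial : ℝ) /
        ((j.factorial : ℝ) * ((k - 2 * j).factorial : ℝ)) * (2 * x) ^ (k - 2 * j) =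
      2 * (Polynomial.Chebyshev.T ℝ k).eval x := by
  have hvanish : ∀ k : ℕ, ∑ j ∈ Finset.range (k + 1),
        (-1 : ℝ) ^ j * ((k - j).choose j : ℝ) * (2 * x) ^ (k - 2 * j) =
      ∑ j ∈ Finset.range (k / 2 + 1),
        (-1 : ℝ) ^ j * ((k - j).choose j : ℝ) * (2 * x) ^ (k - 2 * j) := by
    intro k
    symm
    apply Finset.sum_subset
    · intro j; simp only [Finset.mem_range]; omega
    · intro j h1 h2
      simp only [Finset.mem_range] at h1 h2
      rw [Nat.choose_eq_zero_of_lt (by omega)]; simp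
  rcases Nat.lt_or_ge k 2 with h | h
  · obtain rfl : k = 1 := by omega
    simp
  obtain ⟨m, rfl⟩ := Nat.exists_eq_add_of_le' h
  have hT := congrArg (Polynomial.eval x) (Polynomial.Chebyshev.two_mul_T_eq_U_sub_U ℝ (m : ℤ))
  simp only [Polynomial.eval_sub, Polynomial.eval_mul, Polynomial.eval_ofNat] at hT
  have h2 := chebyshevU_eval_eq_sum x (m + 2)
  have h3 := chebyshevU_eval_eq_sum x m
  rw [hvanish] at h2 h3
  push_cast at h2 ⊢
  rw [hT, h2, h3, show (m + 2) / 2 = m / 2 + 1 by omega, Finset.sum_range_succ',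
    Finset.sum_range_succ' _ (m / 2 + 1), mul_add, Finset.mul_sum, add_sub_right_comm,
    ← Finset.sum_sub_distrib]
  congr 1
  · apply Finset.sum_congr rfl
    intro j hj
    simp only [Finset.mem_range] at hj
    have := factorial_ratio_eq_choose_add_choose (show 2 * (j + 1) ≤ m + 2 by omega)
    push_cast at this
    rw [show m + 2 - 2 * (j + 1) = m - 2 * j by omega] at this
    rw [show m + 2 - 2 * (j + 1) = m - 2 * j by omega, show m + 2 - (j + 1) = m + 1 - j by omega]
    linear_combination (-1 : ℝ) ^ (j + 1) * (2 * x) ^ (m - 2 * j) * this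
  · have : (((m + 1).factorial : ℕ) : ℝ) ≠ 0 := by positivity
    simp [Nat.factorial_succ (m + 1)]
    field_simp
    ring

/-- From $(l)_{m+1}=l\,(l+1)_m$: the pole cancels and what remains is a polynomial in $l$. -/
theorem ratio_mul_gegenbauer {l : ℝ} (hl : l ≠ 0) {k : ℕ} (hk : 1 ≤ k) (ξ : ℝ) :
    (l + k) / l * gegenbauer l k ξ =
      (l + k) * ∑ j ∈ Finset.range (k / 2 + 1),
        (-1 : ℝ) ^ j * (ascPochhammer ℝ (k - j - 1)).eval (l + 1) /
          ((j.factorial : ℝ) * ((k - 2 * j).factorial : ℝ)) * (2 * ξ) ^ (k - 2 * j) := by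
  rw [gegenbauer, div_mul_eq_mul_div, mul_div_assoc, Finset.sum_div]
  congr 1
  apply Finset.sum_congr rfl
  intro j hj
  simp only [Finset.mem_range] at hj
  have h1 : k - j = (k - j - 1) + 1 := by omega
  rw [h1, ascPochhammer_succ_left, Polynomial.eval_mul, Polynomial.eval_comp, Polynomial.eval_X,
    Polynomial.eval_add, Polynomial.eval_X, Polynomial.eval_one, Nat.add_sub_cancel]
  field_simp

theorem ratio_mul_gegenbauer_zero {l : ℝ} (hl : l ≠ 0) (ξ : ℝ) :
    (l + (0 : ℕ)) / l * gegenbauer l 0 ξ = 1 := by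
  simp [gegenbauer, hl]

theorem tendsto_ratio_mul_gegenbauer {k : ℕ} (hk : 1 ≤ k) {ξ : ℝ}
    (hξ : ξ ∈ Set.Icc (-1 : ℝ) 1) :
    Tendsto (fun l : ℝ => (l + k) / l * gegenbauer l k ξ) (𝓝[≠] 0)
      (𝓝 (2 * Real.cos (k * Real.arccos ξ))) := by
  have hcos : 2 * Real.cos (k * Real.arccos ξ) = 2 * (Polynomial.Chebyshev.T ℝ k).eval ξ := by
    have := Polynomial.Chebyshev.T_real_cos (Real.arccos ξ) k
    rw [Real.cos_arccos hξ.1 hξ.2] at this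
    rw [this]; simp
  have hcont : Continuous fun l : ℝ => (l + k) * ∑ j ∈ Finset.range (k / 2 + 1),
        (-1 : ℝ) ^ j * (ascPochhammer ℝ (k - j - 1)).eval (l + 1) /
          ((j.factorial : ℝ) * ((k - 2 * j).factorial : ℝ)) * (2 * ξ) ^ (k - 2 * j) := by
    fun_prop
  have h0 := (hcont.tendsto 0).mono_left (nhdsWithin_le_nhds (s := {0}ᶜ))
  simp only [zero_add, ascPochhammer_eval_one, sum_factorial_ratio_eq_chebyshevT ξ hk] at h0
  rw [hcos]
  refine h0.congr' ?_
  filter_upwards [self_mem_nhdsWithin] with l hl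
  exact (ratio_mul_gegenbauer hl hk ξ).symm

theorem abs_ascPochhammer_eval_le {l : ℝ} (hl : |l| ≤ 1) (m : ℕ) :
    |(ascPochhammer ℝ m).eval (l + 1)| ≤ ((m + 1).factorial : ℝ) := by
  induction m with
  | zero => simp
  | succ m ih =>
    rw [ascPochhammer_succ_eval, abs_mul, Nat.factorial_succ (m + 1), Nat.cast_mul, mul_comm]
    refine mul_le_mul ?_ ih (abs_nonneg _) (by positivity)
    rw [abs_le] at hl ⊢
    push_cast
    constructor <;> linarith [hl.1, hl.2, (Nat.cast_nonneg m : (0 : ℝ) ≤ m)]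

/-- Four factors of at most $2^k$ each: $|l+k|$, the number of summands, the Pochhammer quotient (at
most a binomial coefficient), and the power of $2\xi$. -/
theorem abs_ratio_mul_gegenbauer_le {l : ℝ} (hl0 : l ≠ 0) (hl : |l| ≤ 1) (k : ℕ) {ξ : ℝ}
    (hξ : ξ ∈ Set.Icc (-1 : ℝ) 1) :
    |(l + k) / l * gegenbauer l k ξ| ≤ 16 ^ k := by
  rcases Nat.eq_zero_or_pos k with rfl | hk
  · rw [ratio_mul_gegenbauer_zero hl0]; simp
  have hk2 : (k + 1 : ℝ) ≤ 2 ^ k := by exact_mod_cast Nat.lt_two_pow_self (n := k)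
  have hterm : ∀ j ∈ Finset.range (k / 2 + 1),
      |(-1 : ℝ) ^ j * (ascPochhammer ℝ (k - j - 1)).eval (l + 1) /
          ((j.factorial : ℝ) * ((k - 2 * j).factorial : ℝ)) * (2 * ξ) ^ (k - 2 * j)|
        ≤ 2 ^ k * 2 ^ k := by
    intro j hj
    simp only [Finset.mem_range] at hj
    rw [abs_mul, abs_div, abs_mul, abs_pow, abs_neg, abs_one, one_pow, one_mul,
      abs_of_pos (show (0 : ℝ) < (j.factorial : ℝ) * ((k - 2 * j).factorial : ℝ) by positivity)]
    refine mul_le_mul ?_ ?_ (abs_nonneg _) (by positivity)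
    · have h1 := abs_ascPochhammer_eval_le hl (k - j - 1)
      rw [show k - j - 1 + 1 = k - j by omega] at h1
      calc _ ≤ ((k - j).factorial : ℝ) / ((j.factorial : ℝ) * ((k - 2 * j).factorial : ℝ)) := by
            gcongr
        _ = ((k - j).choose j : ℝ) := by
            rw [Nat.cast_choose ℝ (show j ≤ k - j by omega), show k - j - j = k - 2 * j by omega]
        _ ≤ 2 ^ (k - j) := by exact_mod_cast Nat.choose_le_two_pow _ _
        _ ≤ 2 ^ k := pow_le_pow_right₀ (by norm_num) (by omega)
    · rw [abs_pow]
      calc |2 * ξ| ^ (k - 2 * j) ≤ 2 ^ (k - 2 * j) := by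
            apply pow_le_pow_left₀ (abs_nonneg _)
            rw [abs_mul, abs_two]
            linarith [abs_le.mpr hξ]
        _ ≤ 2 ^ k := pow_le_pow_right₀ (by norm_num) (by omega)
  rw [ratio_mul_gegenbauer hl0 hk, abs_mul]
  calc _ ≤ (k + 1 : ℝ) * ((k + 1 : ℝ) * (2 ^ k * 2 ^ k)) := by
        refine mul_le_mul ?_ ?_ (abs_nonneg _) (by positivity)
        · rw [abs_le] at hl ⊢
          constructor <;> linarith [hl.1, hl.2, (Nat.cast_nonneg k : (0 : ℝ) ≤ k)]
        · refine (Finset.abs_sum_le_sum_abs _ _).trans ((Finset.sum_le_sum hterm).trans ?_)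
          rw [Finset.sum_const, Finset.card_range, nsmul_eq_mul]
          gcongr
          exact_mod_cast Nat.add_le_add_right (Nat.div_le_self k 2) 1
    _ ≤ 2 ^ k * (2 ^ k * (2 ^ k * 2 ^ k)) := by gcongr
    _ = 16 ^ k := by simp only [← mul_pow]; norm_num

/-! ### Bessel functions -/

/-- Keep only the part of Euler's integral over $(R,2R]$. As $R$ is free, this gives geometric decay
in $s$ at any prescribed rate, without Stirling's formula. -/
theorem inv_Gamma_le {R s : ℝ} (hR : 0 < R) (hs : 0 < s) :
    (Real.Gamma s)⁻¹ ≤ 2 * Real.exp (2 * R) * R ^ (-s) := by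
  have key : Real.exp (-(2 * R)) * (R ^ s / (2 * R)) * R ≤ Real.Gamma s := by
    rw [Real.Gamma_eq_integral hs]
    have hint := Real.GammaIntegral_convergent hs
    have hsub : Set.Ioc R (2 * R) ⊆ Set.Ioi 0 := fun x hx => hR.trans hx.1
    calc Real.exp (-(2 * R)) * (R ^ s / (2 * R)) * R
        = ∫ x in Set.Ioc R (2 * R), Real.exp (-(2 * R)) * (R ^ s / (2 * R)) := by
          rw [MeasureTheory.setIntegral_const, Real.volume_real_Ioc_of_le (by linarith)]
          rw [smul_eq_mul]; ring
      _ ≤ ∫ x in Set.Ioc R (2 * R), Real.exp (-x) * x ^ (s - 1) := by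
          refine MeasureTheory.setIntegral_mono_on (MeasureTheory.integrableOn_const (by simp))
            (hint.mono_set hsub) measurableSet_Ioc fun x hx => ?_
          have hx0 : 0 < x := hR.trans hx.1
          rw [Real.rpow_sub_one hx0.ne']
          gcongr
          · exact hx.2
          · exact hx.1.le
          · exact hx.2
      _ ≤ ∫ x in Set.Ioi 0, Real.exp (-x) * x ^ (s - 1) := by
          refine MeasureTheory.setIntegral_mono_set hint ?_ hsub.eventuallyLE
          filter_upwards [MeasureTheory.ae_restrict_mem measurableSet_Ioi] with x hx
          have : (0 : ℝ) < x := hx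
          positivity
  have h1 : 0 < R ^ s := by positivity
  calc (Real.Gamma s)⁻¹ ≤ (Real.exp (-(2 * R)) * (R ^ s / (2 * R)) * R)⁻¹ := by gcongr
    _ = _ := by
      rw [Real.rpow_neg hR.le, Real.exp_neg]
      field_simp

/-- The `n`-th term of the power series of `J_ν(x)`. -/
def besselTerm (ν x : ℝ) (n : ℕ) : ℝ :=
  (-1 : ℝ) ^ n / (n.factorial : ℝ) * (Real.Gamma ((n : ℝ) + ν + 1))⁻¹ *
    (x / 2) ^ (2 * (n : ℝ) + ν)

theorem norm_besselTerm_le {R x ν : ℝ} (hR : 0 < R) (hx : 0 < x) (hν : -1 < ν) (n : ℕ) :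
    ‖besselTerm ν x n‖ ≤
      2 * Real.exp (2 * R) / R * (x / (2 * R)) ^ ν * (((x / 2) ^ 2 / R) ^ n / n.factorial) := by
  have hs : 0 < (n : ℝ) + ν + 1 := by linarith [(Nat.cast_nonneg n : (0 : ℝ) ≤ n)]
  have hG := inv_Gamma_le hR hs
  have hG0 : 0 ≤ (Real.Gamma ((n : ℝ) + ν + 1))⁻¹ := (inv_pos.mpr (Real.Gamma_pos_of_pos hs)).le
  have hx2 : 0 < x / 2 := by positivity
  rw [besselTerm, norm_mul, norm_mul, norm_div, norm_pow, norm_neg, norm_one, one_pow,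
    Real.norm_of_nonneg hG0, Real.norm_natCast, Real.norm_of_nonneg (Real.rpow_nonneg hx2.le _)]
  calc _ ≤ 1 / (n.factorial : ℝ) * (2 * Real.exp (2 * R) * R ^ (-((n : ℝ) + ν + 1))) *
        (x / 2) ^ (2 * (n : ℝ) + ν) := by gcongr
    _ = _ := by
      rw [show -((n : ℝ) + ν + 1) = -(n : ℝ) + -ν + -1 by ring, Real.rpow_add hR,
        Real.rpow_add hR, Real.rpow_add hx2, Real.rpow_neg_one, Real.rpow_neg hR.le,
        Real.rpow_neg hR.le, Real.rpow_natCast, show (2 * (n : ℝ)) = ((2 * n : ℕ) : ℝ) by simp,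
        Real.rpow_natCast, show x / (2 * R) = (x / 2) / R by field_simp,
        Real.div_rpow hx2.le hR.le, div_pow _ R n, pow_mul]
      field_simp

theorem summable_pow_div_factorial_const (C y : ℝ) :
    Summable fun n : ℕ => C * (y ^ n / (n.factorial : ℝ)) :=
  (Real.summable_pow_div_factorial y).mul_left C

theorem abs_besselJ_le {R x ν : ℝ} (hR : 0 < R) (hx : 0 < x) (hν : -1 < ν) :
    |besselJ ν x| ≤
      2 * Real.exp (2 * R) / R * (x / (2 * R)) ^ ν * Real.exp ((x / 2) ^ 2 / R) := by
  have h := tsum_of_norm_bounded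
    ((NormedSpace.expSeries_div_hasSum_exp ((x / 2) ^ 2 / R)).mul_left
      (2 * Real.exp (2 * R) / R * (x / (2 * R)) ^ ν)) (norm_besselTerm_le hR hx hν)
  rw [← Real.exp_eq_exp_ℝ] at h
  exact h

theorem continuousAt_besselJ {x ν : ℝ} (hx : 0 < x) (hν : -1 < ν) :
    ContinuousAt (fun ν => besselJ ν x) ν := by
  have hx2 : 0 < x / 2 := by positivity
  -- With $R=x/2$ the factor $(x/(2R))^\nu$ is $1$, so the majorant does not depend on the order.
  refine tendsto_tsum_of_dominated_convergence
    (summable_pow_div_factorial_const (2 * Real.exp (2 * (x / 2)) / (x / 2)) (x / 2)) ?_ ?_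
  · intro n
    have hs : 0 < (n : ℝ) + ν + 1 := by linarith [(Nat.cast_nonneg n : (0 : ℝ) ≤ n)]
    have hG : ContinuousAt (fun ν : ℝ => Real.Gamma ((n : ℝ) + ν + 1)) ν := by
      have h1 : ContinuousAt Real.Gamma ((n : ℝ) + ν + 1) :=
        (Real.differentiableAt_Gamma fun m => by
          have : (0 : ℝ) ≤ m := Nat.cast_nonneg m
          linarith).continuousAt
      exact ContinuousAt.comp' (g := Real.Gamma) h1 (by fun_prop)
    have hP : ContinuousAt (fun ν : ℝ => (x / 2) ^ (2 * (n : ℝ) + ν)) ν :=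
      (Real.continuous_const_rpow hx2.ne').continuousAt.comp' (by fun_prop)
    exact (continuousAt_const.mul (hG.inv₀ (Real.Gamma_pos_of_pos hs).ne')).mul hP
  · filter_upwards [lt_mem_nhds hν] with μ hμ n
    refine (norm_besselTerm_le hx2 hx hμ n).trans_eq ?_
    rw [show x / (2 * (x / 2)) = 1 by field_simp, Real.one_rpow, mul_one]
    congr 3
    field_simp

/-! ### The limit `l → 0` of the general kernel -/

theorem tendsto_kernelTerm {z : ℝ} (hz : 0 < z) {ξ : ℝ} (hξ : ξ ∈ Set.Icc (-1 : ℝ) 1) (k : ℕ) :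
    Tendsto (fun l : ℝ => kernelTerm 4 l z ξ k) (𝓝[≠] 0)
      (𝓝 ((if k = 0 then 1 else 2) * planarTerm 4 z ξ k)) := by
  have hx : (0 : ℝ) < 2 / 4 * z ^ ((4 : ℝ) / 2) := by positivity
  have hw : Tendsto (fun l : ℝ => (l + k) / l * gegenbauer l k ξ) (𝓝[≠] 0)
      (𝓝 ((if k = 0 then 1 else 2) * Real.cos (k * Real.arccos ξ))) := by
    rcases Nat.eq_zero_or_pos k with rfl | hk
    · simp only [↓reduceIte, Nat.cast_zero, zero_mul, Real.cos_zero, mul_one]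
      refine tendsto_const_nhds.congr' ?_
      filter_upwards [self_mem_nhdsWithin] with l hl
      simpa using (ratio_mul_gegenbauer_zero hl ξ).symm
    · rw [if_neg hk.ne']
      exact tendsto_ratio_mul_gegenbauer hk hξ
  have hJ : Tendsto (fun l : ℝ => besselJ (2 * ((k : ℝ) + l) / 4) (2 / 4 * z ^ ((4 : ℝ) / 2)))
      (𝓝[≠] 0) (𝓝 (besselJ (2 * (k : ℝ) / 4) (2 / 4 * z ^ ((4 : ℝ) / 2)))) := by
    have h1 : ContinuousAt (fun l : ℝ =>
        besselJ (2 * ((k : ℝ) + l) / 4) (2 / 4 * z ^ ((4 : ℝ) / 2))) 0 := by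
      refine ContinuousAt.comp' (g := fun ν => besselJ ν (2 / 4 * z ^ ((4 : ℝ) / 2)))
        (continuousAt_besselJ hx ?_) (by fun_prop)
      have : (0 : ℝ) ≤ k := Nat.cast_nonneg k
      linarith
    have h2 := h1.tendsto.mono_left (nhdsWithin_le_nhds (s := {0}ᶜ))
    simpa using h2
  have hzl : Tendsto (fun l : ℝ => z ^ (-l)) (𝓝[≠] 0) (𝓝 1) := by
    have h1 : Continuous fun l : ℝ => z ^ (-l) :=
      (Real.continuous_const_rpow hz.ne').comp' (by fun_prop)
    simpa using (h1.tendsto 0).mono_left (nhdsWithin_le_nhds (s := {0}ᶜ))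
  have hprod := (Complex.continuous_ofReal.tendsto _).comp ((hw.mul hzl).mul hJ)
  have := hprod.const_mul (Complex.exp (-(Complex.I * (Real.pi : ℂ) * (k : ℂ) / ((4 : ℝ) : ℂ))))
  convert this using 2
  · simp only [kernelTerm, Function.comp]
    congr 2
    ring
  · rw [planarTerm]
    split_ifs <;> push_cast <;> ring

theorem exists_norm_kernelTerm_le {z : ℝ} (hz : 0 < z) {ξ : ℝ} (hξ : ξ ∈ Set.Icc (-1 : ℝ) 1) :
    ∃ C : ℝ, ∀ᶠ l : ℝ in 𝓝[≠] 0, ∀ k, ‖kernelTerm 4 l z ξ k‖ ≤ C * (1 / 2) ^ k := by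
  set x := 2 / 4 * z ^ ((4 : ℝ) / 2) with hx_def
  have hx : 0 < x := by positivity
  -- With $R=512x$, $x/(2R)=(1/32)^2$, which at order $(k+l)/2$ gives $(1/32)^{k+l}$. Against $16^k$
  -- this leaves $(1/2)^k$. In the final constant, $2$ bounds $z^{-l}$ and $32$ bounds $(1/32)^l$.
  set B := 2 * Real.exp (2 * (512 * x)) / (512 * x) * Real.exp ((x / 2) ^ 2 / (512 * x))
  have hB : 0 ≤ B := by positivity
  refine ⟨2 * (B * 32), ?_⟩
  have h1 : ∀ᶠ l : ℝ in 𝓝 0, z ^ (-l) ≤ 2 := by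
    have h1 : Continuous fun l : ℝ => z ^ (-l) :=
      (Real.continuous_const_rpow hz.ne').comp' (by fun_prop)
    have := h1.tendsto 0
    simp only [neg_zero, Real.rpow_zero] at this
    filter_upwards [this.eventually (gt_mem_nhds one_lt_two)] with l hl using hl.le
  have h2 : ∀ᶠ l : ℝ in 𝓝 0, |l| ≤ 1 := by
    filter_upwards [Metric.ball_mem_nhds (0 : ℝ) one_pos] with l hl
    simpa using (mem_ball_zero_iff.mp hl).le
  filter_upwards [nhdsWithin_le_nhds h1, nhdsWithin_le_nhds h2, self_mem_nhdsWithin]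
    with l hzl hl hl0 k
  have hk : (0 : ℝ) ≤ k := Nat.cast_nonneg k
  have hJ : |besselJ (2 * ((k : ℝ) + l) / 4) x| ≤ B * 32 * (1 / 32) ^ k := by
    refine (abs_besselJ_le (show 0 < 512 * x by positivity) hx
      (by linarith [(abs_le.mp hl).1])).trans ?_
    rw [show x / (2 * (512 * x)) = (1 / 32) ^ (2 : ℝ) by
      rw [Real.rpow_two]; field_simp; norm_num, ← Real.rpow_mul (by norm_num),
      show 2 * (2 * ((k : ℝ) + l) / 4) = k + l by ring, Real.rpow_add (by norm_num),
      Real.rpow_natCast]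
    have : (1 / 32 : ℝ) ^ l ≤ 32 := by
      calc (1 / 32 : ℝ) ^ l ≤ (1 / 32) ^ (-1 : ℝ) :=
            Real.rpow_le_rpow_of_exponent_ge (by norm_num) (by norm_num) (abs_le.mp hl).1
        _ = 32 := by rw [Real.rpow_neg_one]; norm_num
    calc _ = B * (1 / 32 : ℝ) ^ l * (1 / 32) ^ k := by ring
      _ ≤ _ := by gcongr
  have hgeg := abs_ratio_mul_gegenbauer_le hl0 hl k hξ
  have hexp : ‖Complex.exp (-(Complex.I * (Real.pi : ℂ) * (k : ℂ) / ((4 : ℝ) : ℂ)))‖ = 1 := by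
    rw [show -(Complex.I * (Real.pi : ℂ) * (k : ℂ) / ((4 : ℝ) : ℂ)) =
      ((-(Real.pi * k / 4) : ℝ) : ℂ) * Complex.I by push_cast; ring]
    exact Complex.norm_exp_ofReal_mul_I _
  rw [kernelTerm, norm_mul, hexp, one_mul, Complex.norm_real, Real.norm_eq_abs, ← hx_def,
    show (l + (k : ℝ)) / l * z ^ (-l) * besselJ (2 * ((k : ℝ) + l) / 4) x * gegenbauer l k ξ =
      z ^ (-l) * besselJ (2 * ((k : ℝ) + l) / 4) x * ((l + (k : ℝ)) / l * gegenbauer l k ξ) by ring,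
    abs_mul, abs_mul, abs_of_nonneg (Real.rpow_nonneg hz.le _)]
  calc _ ≤ 2 * (B * 32 * (1 / 32) ^ k) * 16 ^ k := by gcongr
    _ = 2 * (B * 32) * ((1 / 32) ^ k * 16 ^ k) := by ring
    _ = _ := by rw [← mul_pow]; norm_num

theorem summable_const_mul_half_pow (C : ℝ) : Summable fun k : ℕ => C * (1 / 2 : ℝ) ^ k :=
  (summable_geometric_of_lt_one (by norm_num) (by norm_num)).mul_left C

theorem eventually_summable_kernelTerm {z : ℝ} (hz : 0 < z) {ξ : ℝ}
    (hξ : ξ ∈ Set.Icc (-1 : ℝ) 1) :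
    ∀ᶠ l : ℝ in 𝓝[≠] 0, Summable (kernelTerm 4 l z ξ) := by
  obtain ⟨C, hC⟩ := exists_norm_kernelTerm_le hz hξ
  filter_upwards [hC] with l hl
  exact (summable_const_mul_half_pow C).of_norm_bounded hl

theorem tendsto_kernel {z : ℝ} (hz : 0 < z) {ξ : ℝ} (hξ : ξ ∈ Set.Icc (-1 : ℝ) 1)
    (hsum : Summable fun k : ℕ => planarTerm 4 z ξ (k + 1)) :
    Tendsto (fun l : ℝ => kernel 4 l z ξ) (𝓝[≠] 0) (𝓝 (planarKernel 4 z ξ)) := by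
  obtain ⟨C, hC⟩ := exists_norm_kernelTerm_le hz hξ
  have h := tendsto_tsum_of_dominated_convergence (summable_const_mul_half_pow C)
    (tendsto_kernelTerm hz hξ) hC
  have hconst : Tendsto
      (fun l : ℝ => (((4 : ℝ) ^ (2 * l / 4) * Real.Gamma ((2 * l + 4) / 4) : ℝ) : ℂ))
      (𝓝[≠] 0) (𝓝 1) := by
    have h1 : ContinuousAt (fun l : ℝ => (4 : ℝ) ^ (2 * l / 4)) 0 :=
      (Real.continuous_const_rpow (by norm_num)).continuousAt.comp' (by fun_prop)
    have h2 : ContinuousAt (fun l : ℝ => Real.Gamma ((2 * l + 4) / 4)) 0 := by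
      have h : ContinuousAt Real.Gamma ((2 * 0 + 4) / 4) :=
        (Real.differentiableAt_Gamma fun m => by
          have : (0 : ℝ) ≤ m := Nat.cast_nonneg m
          linarith).continuousAt
      exact ContinuousAt.comp' (g := Real.Gamma) h (by fun_prop)
    have h3 : Tendsto
        (fun l : ℝ => (((4 : ℝ) ^ (2 * l / 4) * Real.Gamma ((2 * l + 4) / 4) : ℝ) : ℂ)) (𝓝[≠] 0)
        (𝓝 (((4 : ℝ) ^ (2 * (0 : ℝ) / 4) * Real.Gamma ((2 * 0 + 4) / 4) : ℝ) : ℂ)) := (Complex.continuous_ofReal.tendsto _).comp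
      ((h1.mul h2).tendsto.mono_left (nhdsWithin_le_nhds (s := {0}ᶜ)))
    simpa using h3
  have hsum' : Summable fun k : ℕ => (if k = 0 then 1 else 2) * planarTerm 4 z ξ k := by
    rw [← summable_nat_add_iff 1]
    simpa using hsum.mul_left 2
  have hlim : planarKernel 4 z ξ = 1 * ∑' k : ℕ, (if k = 0 then 1 else 2) * planarTerm 4 z ξ k := by
    rw [hsum'.tsum_eq_zero_add, one_mul, planarKernel, ← tsum_mul_left]
    simp [planarTerm]
  rw [hlim]
  exact hconst.mul h

/-! ### The coefficients of the planar kernel as a power series in `z` -/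

/-- The generalized binomial coefficient `C(x, n)` divided by `Γ(x + 1)`. -/
def binomGamma (x : ℝ) (n : ℕ) : ℝ := (n.factorial * Real.Gamma (x - n + 1))⁻¹

theorem add_one_mul_binomGamma_zero {x : ℝ} (hx : x + 1 ≠ 0) :
    (x + 1) * binomGamma (x + 1) 0 = binomGamma x 0 := by
  simp only [binomGamma, Nat.cast_zero, sub_zero, Real.Gamma_add_one hx]
  field_simp

/-- Pascal's rule. It holds for every real $x$ because `Real.Gamma` is $0$ at its poles, so that its
inverse there agrees with the entire function $1/\Gamma$. -/
theorem add_one_mul_binomGamma_succ (x : ℝ) (n : ℕ) :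
    (x + 1) * binomGamma (x + 1) (n + 1) = binomGamma x (n + 1) + binomGamma x n := by
  simp only [binomGamma, Nat.factorial_succ, Nat.cast_mul, Nat.cast_add, Nat.cast_one]
  rw [show x + 1 - (n + 1) + 1 = x - n + 1 by ring, show x - (n + 1) + 1 = x - n by ring]
  have hn : (n.factorial : ℝ) ≠ 0 := by positivity
  have hn1 : (n : ℝ) + 1 ≠ 0 := by positivity
  rcases eq_or_ne (x - n) 0 with h | h
  · rw [h, Real.Gamma_zero, sub_eq_zero.mp h]
    simp
    field_simp
  · rw [Real.Gamma_add_one h]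
    by_cases hG : Real.Gamma (x - n) = 0
    · simp [hG]
    · field_simp
      ring

/-- The `n`-th contribution to the coefficient of `(ρ z) ^ N` in the planar kernel, up to the
factor `1` or `2`. -/
def planarSummand (θ : ℝ) (N n : ℕ) : ℝ :=
  binomGamma (N / 2) n * Real.cos ((N - 4 * n) * θ)

/-- The coefficient of `(ρ z) ^ N` in the planar kernel, where `ρ = exp (-iπ/4) / 2`. -/
def planarCoeff (θ : ℝ) (N : ℕ) : ℝ :=
  ∑ n ∈ Finset.range (N / 4 + 1), (if N - 4 * n = 0 then 1 else 2) * planarSummand θ N n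

/-- Pascal's rule splits each summand in two. With $A=(N-4n)\theta$, the pieces carrying the same
coefficient pair up as $\cos(A+2\theta)+\cos(A-2\theta)=2\cos2\theta\cos A$; only the piece with
$n=M$ has no partner. -/
theorem sum_planarSummand_succ (θ : ℝ) (N M : ℕ) :
    ((N : ℝ) / 2 + 1) * ∑ n ∈ Finset.range (M + 1), planarSummand θ (N + 2) n =
      2 * Real.cos (2 * θ) * ∑ n ∈ Finset.range M, planarSummand θ N n +
        binomGamma (N / 2) M * Real.cos ((N + 2 - 4 * M) * θ) := by
  have hx : (N : ℝ) / 2 + 1 ≠ 0 := by positivity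
  have hN : (((N + 2 : ℕ) : ℝ) / 2) = (N : ℝ) / 2 + 1 := by push_cast; ring
  induction M with
  | zero =>
    simp only [zero_add, Finset.sum_range_one, Finset.sum_range_zero, planarSummand, hN,
      ← mul_assoc, add_one_mul_binomGamma_zero hx]
    push_cast
    ring_nf
  | succ M ih =>
    rw [Finset.sum_range_succ, mul_add, ih, Finset.sum_range_succ _ M]
    simp only [planarSummand, hN, ← mul_assoc, add_one_mul_binomGamma_succ]
    have h1 : Real.cos ((N + 2 - 4 * M) * θ) =
        Real.cos ((N - 4 * M) * θ + 2 * θ) := by ring_nf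
    have h2 : Real.cos ((((N + 2 : ℕ) : ℝ) - 4 * ((M + 1 : ℕ) : ℝ)) * θ) =
        Real.cos ((N - 4 * M) * θ - 2 * θ) := by push_cast; ring_nf
    have h3 : Real.cos (((N : ℝ) + 2 - 4 * ((M + 1 : ℕ) : ℝ)) * θ) =
        Real.cos ((N - 4 * M) * θ - 2 * θ) := by push_cast; ring_nf
    rw [h1, h2, h3, Real.cos_add, Real.cos_sub]
    ring

theorem planarCoeff_four_mul (θ : ℝ) (q : ℕ) :
    planarCoeff θ (4 * q) =
      2 * ∑ n ∈ Finset.range q, planarSummand θ (4 * q) n + binomGamma (2 * q) q := by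
  rw [planarCoeff, show 4 * q / 4 = q by omega, Finset.sum_range_succ, Finset.mul_sum]
  congr 1
  · refine Finset.sum_congr rfl fun n hn => ?_
    rw [Finset.mem_range] at hn
    rw [if_neg (by omega)]
  · simp [planarSummand, show (4 * (q : ℝ)) / 2 = 2 * q by ring]

theorem planarCoeff_of_not_dvd (θ : ℝ) {N : ℕ} (hN : ¬ 4 ∣ N) :
    planarCoeff θ N = 2 * ∑ n ∈ Finset.range (N / 4 + 1), planarSummand θ N n := by
  rw [planarCoeff, Finset.mul_sum]
  refine Finset.sum_congr rfl fun n hn => ?_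
  rw [Finset.mem_range] at hn
  rw [if_neg (by omega)]

/-- Legendre's duplication formula. This and `binomGamma_double_succ` evaluate the unpaired terms in
odd degree. -/
theorem binomGamma_double (q : ℕ) :
    binomGamma (2 * q + 1 / 2) q = 2 ^ (2 * q + 1) / (√Real.pi * (2 * q + 1).factorial) := by
  have h := Real.Gamma_mul_Gamma_add_half ((q : ℝ) + 1)
  rw [Real.Gamma_nat_eq_factorial, show 2 * ((q : ℝ) + 1) = ((2 * q + 1 : ℕ) : ℝ) + 1 by
    push_cast; ring, Real.Gamma_nat_eq_factorial,
    show 1 - (((2 * q + 1 : ℕ) : ℝ) + 1) = -((2 * q + 1 : ℕ) : ℝ) by ring,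
    Real.rpow_neg two_pos.le, Real.rpow_natCast] at h
  rw [binomGamma, show 2 * (q : ℝ) + 1 / 2 - q + 1 = q + 1 + 1 / 2 by ring, h]
  field_simp

theorem binomGamma_double_succ (q : ℕ) :
    binomGamma (2 * q + 3 / 2) (q + 1) =
      2 ^ (2 * q + 2) / (√Real.pi * (2 * q + 2).factorial) := by
  have h := Real.Gamma_mul_Gamma_add_half ((q : ℝ) + 1 + 1 / 2)
  rw [show (q : ℝ) + 1 + 1 / 2 + 1 / 2 = ((q + 1 : ℕ) : ℝ) + 1 by push_cast; ring,
    Real.Gamma_nat_eq_factorial, show 2 * ((q : ℝ) + 1 + 1 / 2) = ((2 * q + 2 : ℕ) : ℝ) + 1 by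
    push_cast; ring, Real.Gamma_nat_eq_factorial,
    show 1 - (((2 * q + 2 : ℕ) : ℝ) + 1) = -((2 * q + 2 : ℕ) : ℝ) by ring,
    Real.rpow_neg two_pos.le, Real.rpow_natCast] at h
  rw [binomGamma, show 2 * (q : ℝ) + 3 / 2 - ((q + 1 : ℕ) : ℝ) + 1 = q + 1 + 1 / 2 by
    push_cast; ring, mul_comm, h]
  field_simp

theorem binomGamma_symm (q : ℕ) :
    binomGamma (2 * q + 1) (q + 1) = binomGamma (2 * q + 1) q := by
  rw [binomGamma, binomGamma, show 2 * (q : ℝ) + 1 - ((q + 1 : ℕ) : ℝ) + 1 = q + 1 by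
    push_cast; ring, show 2 * (q : ℝ) + 1 - q + 1 = ((q + 1 : ℕ) : ℝ) + 1 by push_cast; ring,
    Real.Gamma_nat_eq_factorial, Real.Gamma_nat_eq_factorial, mul_comm]

theorem planarCoeff_even_recurrence (θ : ℝ) (j : ℕ) :
    (2 * j + 2 : ℝ) * planarCoeff θ (2 * j + 2) =
      4 * Real.cos (2 * θ) * planarCoeff θ (2 * j) := by
  obtain ⟨q, rfl | rfl⟩ := Nat.even_or_odd' j
  · have h := sum_planarSummand_succ θ (4 * q) q
    rw [show 2 * (2 * q) = 4 * q by ring, planarCoeff_of_not_dvd θ (N := 4 * q + 2) (by omega),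
      planarCoeff_four_mul, show (4 * q + 2) / 4 = q by omega]
    push_cast at h ⊢
    rw [show 4 * (q : ℝ) / 2 = 2 * q by ring, show 4 * (q : ℝ) + 2 - 4 * q = 2 by ring] at h
    linear_combination 4 * h
  · have h := sum_planarSummand_succ θ (4 * q + 2) (q + 1)
    have hs : planarSummand θ (4 * (q + 1)) (q + 1) = binomGamma (2 * q + 1 + 1) (q + 1) := by
      rw [planarSummand]
      push_cast
      rw [show 4 * ((q : ℝ) + 1) / 2 = 2 * q + 1 + 1 by ring]
      simp
    -- Passing to degree $4q+4$ creates a central summand of weight $1$ instead of $2$. By Pascal's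
    -- rule and symmetry this deficit exactly cancels the unpaired term.
    have hb := add_one_mul_binomGamma_succ (2 * q + 1) q
    rw [binomGamma_symm] at hb
    rw [show 2 * (2 * q + 1) + 2 = 4 * (q + 1) by ring, planarCoeff_four_mul,
      show 2 * (2 * q + 1) = 4 * q + 2 by ring,
      planarCoeff_of_not_dvd θ (N := 4 * q + 2) (by omega), show (4 * q + 2) / 4 = q by omega]
    rw [show 4 * q + 2 + 2 = 4 * (q + 1) by ring, Finset.sum_range_succ, hs] at h
    push_cast at h ⊢
    rw [show (4 * (q : ℝ) + 2) / 2 = 2 * q + 1 by ring, binomGamma_symm,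
      show (4 * (q : ℝ) + 2 + 2 - 4 * (q + 1)) = 0 by ring, zero_mul, Real.cos_zero] at h
    rw [show 2 * ((q : ℝ) + 1) = 2 * q + 1 + 1 by ring]
    linear_combination 4 * h - 2 * hb

/-- In odd degree no central summand absorbs the unpaired term. It contributes $+\cos\theta$ for odd
$j$, and $\cos3\theta-2\cos2\theta\cos\theta=-\cos\theta$ for even $j$, hence the sign of
$(-2)^{j+1}$. -/
theorem planarCoeff_odd_recurrence (θ : ℝ) (j : ℕ) :
    (2 * j + 3 : ℝ) * planarCoeff θ (2 * j + 3) =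
      4 * Real.cos (2 * θ) * planarCoeff θ (2 * j + 1) +
        4 * Real.cos θ * ((-2) ^ (j + 1) / (√Real.pi * (j + 1).factorial)) := by
  obtain ⟨q, rfl | rfl⟩ := Nat.even_or_odd' j
  · have h := sum_planarSummand_succ θ (4 * q + 1) q
    have hb := binomGamma_double q
    rw [show 2 * (2 * q) + 3 = 4 * q + 3 by ring, show 2 * (2 * q) + 1 = 4 * q + 1 by ring,
      planarCoeff_of_not_dvd θ (N := 4 * q + 3) (by omega),
      planarCoeff_of_not_dvd θ (N := 4 * q + 1) (by omega),
      show (4 * q + 3) / 4 = q by omega, show (4 * q + 1) / 4 = q by omega,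
      Finset.sum_range_succ (fun n => planarSummand θ (4 * q + 1) n),
      Odd.neg_pow ⟨q, rfl⟩, neg_div, ← hb]
    have hs : planarSummand θ (4 * q + 1) q = binomGamma (2 * q + 1 / 2) q * Real.cos θ := by
      rw [planarSummand]
      push_cast
      rw [show (4 * (q : ℝ) + 1) / 2 = 2 * q + 1 / 2 by ring,
        show (4 * (q : ℝ) + 1 - 4 * q) = 1 by ring, one_mul]
    rw [hs]
    push_cast at h ⊢
    rw [show (4 * (q : ℝ) + 1) / 2 = 2 * q + 1 / 2 by ring,
      show (4 * (q : ℝ) + 1 + 2 - 4 * q) * θ = 3 * θ by ring, Real.cos_three_mul] at h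
    rw [Real.cos_two_mul] at h ⊢
    linear_combination 4 * h
  · have h := sum_planarSummand_succ θ (4 * q + 3) (q + 1)
    have hb := binomGamma_double_succ q
    rw [show 2 * (2 * q + 1) + 3 = 4 * q + 5 by ring, show 2 * (2 * q + 1) + 1 = 4 * q + 3 by ring,
      planarCoeff_of_not_dvd θ (N := 4 * q + 5) (by omega),
      planarCoeff_of_not_dvd θ (N := 4 * q + 3) (by omega),
      show (4 * q + 5) / 4 = q + 1 by omega, show (4 * q + 3) / 4 = q by omega,
      show 2 * q + 1 + 1 = 2 * q + 2 by ring,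
      Even.neg_pow ⟨q + 1, by ring⟩, ← hb]
    push_cast at h ⊢
    rw [show (4 * (q : ℝ) + 3) / 2 = 2 * q + 3 / 2 by ring,
      show (4 * (q : ℝ) + 3 + 2 - 4 * (q + 1)) * θ = θ by ring] at h
    linear_combination 4 * h

theorem planarCoeff_zero (θ : ℝ) : planarCoeff θ 0 = 1 := by
  simp [planarCoeff, planarSummand, binomGamma]

theorem planarCoeff_one (θ : ℝ) : planarCoeff θ 1 = 4 * Real.cos θ / √Real.pi := by
  have h := binomGamma_double 0
  norm_num at h
  simp [planarCoeff, planarSummand]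
  rw [show (2⁻¹ : ℝ) = 1 / 2 by norm_num, h]
  ring

/-! ### The planar kernel as a power series in `z` -/

/-- The constant `exp (-iπ/4) / 2`. -/
def rho : ℂ := Complex.exp (-(Complex.I * ((Real.pi : ℂ) / 4))) / 2

theorem two_mul_rho : 2 * rho = (1 - Complex.I) * (√2 / 2 : ℝ) := by
  rw [rho, show -(Complex.I * ((Real.pi : ℂ) / 4)) = ((-(Real.pi / 4) : ℝ) : ℂ) * Complex.I by
    push_cast; ring, Complex.exp_mul_I, ← Complex.ofReal_cos, ← Complex.ofReal_sin, Real.cos_neg,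
    Real.sin_neg, Real.cos_pi_div_four, Real.sin_pi_div_four]
  push_cast
  ring

theorem rho_sq : rho ^ 2 = -Complex.I / 4 := by
  have h : (2 * rho) ^ 2 = -Complex.I := by
    rw [two_mul_rho, mul_pow, ← Complex.ofReal_pow, div_pow, Real.sq_sqrt two_pos.le]
    push_cast
    linear_combination (1 / 2 : ℂ) * Complex.I_sq
  linear_combination h / 4

theorem norm_rho : ‖rho‖ = 1 / 2 := by
  rw [rho, norm_div, show -(Complex.I * ((Real.pi : ℂ) / 4)) =
    ((-(Real.pi / 4) : ℝ) : ℂ) * Complex.I by push_cast; ring, Complex.norm_exp_ofReal_mul_I]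
  simp

theorem exp_neg_I_pi_mul_div_four (k : ℕ) :
    Complex.exp (-(Complex.I * (Real.pi : ℂ) * (k : ℂ) / ((4 : ℝ) : ℂ))) = (2 * rho) ^ k := by
  rw [rho, mul_div_cancel₀ _ two_ne_zero, ← Complex.exp_nat_mul]
  congr 1
  push_cast
  ring

/-- The terms of the planar kernel, with the Bessel functions expanded. -/
def planarDouble (θ z : ℝ) (p : ℕ × ℕ) : ℂ :=
  (((if p.2 = 0 then 1 else 2) * planarSummand θ (4 * p.1 + p.2) p.1 : ℝ) : ℂ) *
    (rho * z) ^ (4 * p.1 + p.2)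

theorem abs_planarSummand_le (θ : ℝ) {S : ℝ} (hS : 0 < S) (n k : ℕ) :
    |planarSummand θ (4 * n + k) n| ≤
      2 * Real.exp (2 * S ^ 2) * (S ^ (2 * n + k + 2))⁻¹ / n.factorial := by
  have hs : (0 : ℝ) < n + k / 2 + 1 := by positivity
  have hG := inv_Gamma_le (show 0 < S ^ 2 by positivity) hs
  have hGpos := Real.Gamma_pos_of_pos hs
  rw [planarSummand, binomGamma, abs_mul]
  push_cast
  rw [show (4 * (n : ℝ) + k) / 2 - n + 1 = n + k / 2 + 1 by ring,
    abs_of_pos (inv_pos.mpr (by positivity)), mul_inv]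
  have hrpow : (S ^ 2) ^ (-((n : ℝ) + k / 2 + 1)) = (S ^ (2 * n + k + 2))⁻¹ := by
    rw [← Real.rpow_natCast S 2, ← Real.rpow_mul hS.le, ← Real.rpow_natCast, ← Real.rpow_neg hS.le]
    congr 1
    push_cast
    ring
  rw [hrpow] at hG
  calc _ ≤ (n.factorial : ℝ)⁻¹ * (2 * Real.exp (2 * S ^ 2) * (S ^ (2 * n + k + 2))⁻¹) * 1 := by
        gcongr
        exact Real.abs_cos_le_one _
    _ = _ := by ring

/-- With $S=|z|+1$ the powers $(|z|/S)^k$ are at most $1$: $|\rho|=1/2$ supplies decay in $k$ and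
the factorial supplies it in $n$. This licenses every rearrangement below. -/
theorem summable_planarDouble (θ z : ℝ) : Summable (planarDouble θ z) := by
  set S := |z| + 1 with hS_def
  have hS : 0 < S := by positivity
  have hgeo : Summable fun k : ℕ => (1 / 2 : ℝ) ^ k :=
    summable_geometric_of_lt_one (by norm_num) (by norm_num)
  have hsum := (Summable.mul_of_nonneg
    (Real.summable_pow_div_factorial (|z| ^ 4 / 16 / S ^ 2)) hgeo (fun n => by positivity)
    (fun k => by positivity)).mul_left (4 * Real.exp (2 * S ^ 2) / S ^ 2)
  refine hsum.of_norm_bounded fun ⟨n, k⟩ => ?_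
  rw [planarDouble, norm_mul, norm_pow, norm_mul, norm_rho, Complex.norm_real, Complex.norm_real,
    norm_mul, Real.norm_eq_abs, Real.norm_eq_abs, Real.norm_eq_abs]
  have h1 : |(if k = 0 then 1 else 2 : ℝ)| ≤ 2 := by split_ifs <;> norm_num
  have hz : |z| / S ≤ 1 := by
    rw [div_le_one hS]; linarith
  calc _ ≤ 2 * (2 * Real.exp (2 * S ^ 2) * (S ^ (2 * n + k + 2))⁻¹ / n.factorial) *
          (1 / 2 * |z|) ^ (4 * n + k) := by
        gcongr
        exact abs_planarSummand_le θ hS n k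
    _ = 4 * Real.exp (2 * S ^ 2) / S ^ 2 * ((|z| ^ 4 / 16 / S ^ 2) ^ n / n.factorial *
          ((1 / 2) ^ k * (|z| / S) ^ k)) := by
        simp only [pow_add, pow_mul, div_pow, mul_pow]
        field_simp
        norm_num
        ring
    _ ≤ 4 * Real.exp (2 * S ^ 2) / S ^ 2 * ((|z| ^ 4 / 16 / S ^ 2) ^ n / n.factorial *
          ((1 / 2) ^ k * 1)) := by
        gcongr
        exact pow_le_one₀ (by positivity) hz
    _ = _ := by simp

/-- Reindexes by $(N,n)$ with $N=4n+k$, extending by zero where $4n>N$; each fibre over $N$ is then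
a finite sum. -/
theorem hasSum_planarCoeff (θ z : ℝ) :
    HasSum (fun N : ℕ => (planarCoeff θ N : ℂ) * (rho * z) ^ N) (∑' p, planarDouble θ z p) := by
  let e : ℕ × ℕ → ℕ × ℕ := fun p => (4 * p.1 + p.2, p.1)
  have he : Function.Injective e := by
    rintro ⟨a, b⟩ ⟨c, d⟩ h
    simp only [e, Prod.mk.injEq] at h ⊢
    omega
  let g : ℕ × ℕ → ℂ := fun q =>
    if 4 * q.2 ≤ q.1 then planarDouble θ z (q.2, q.1 - 4 * q.2) else 0
  have hge : g ∘ e = planarDouble θ z := by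
    funext ⟨n, k⟩
    simp [g, e]
  have hg0 : ∀ q ∉ Set.range e, g q = 0 := by
    rintro ⟨N, n⟩ hq
    refine if_neg fun h => hq ⟨(n, N - 4 * n), ?_⟩
    simp only [e, Prod.mk.injEq, and_true] at h ⊢
    omega
  have hg : HasSum g (∑' p, planarDouble θ z p) := by
    rw [← he.hasSum_iff hg0, hge]
    exact (summable_planarDouble θ z).hasSum
  refine hg.prod_fiberwise fun N => ?_
  have hfin : HasSum (fun n => g (N, n)) (∑ n ∈ Finset.range (N / 4 + 1), g (N, n)) :=
    hasSum_sum_of_ne_finset_zero fun n hn => if_neg (by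
      simp only [Finset.mem_range] at hn ⊢
      omega)
  convert hfin using 1
  rw [planarCoeff, Complex.ofReal_sum, Finset.sum_mul]
  refine Finset.sum_congr rfl fun n hn => ?_
  rw [Finset.mem_range] at hn
  have h4 : 4 * n ≤ N := by omega
  simp only [g, if_pos h4, planarDouble]
  rw [show 4 * n + (N - 4 * n) = N by omega]

/-- Since $\rho^4=-1/16$, the power $(\rho z)^{4n+k}$ carries both the Bessel sign $(-1)^n$ and the
phase $e^{-i\pi k/4}=(2\rho)^k$. -/
theorem planarDouble_eq {z ξ : ℝ} (hz : 0 ≤ z) (k n : ℕ) :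
    planarDouble (Real.arccos ξ) z (n, k) =
      (if k = 0 then 1 else 2) *
        (Complex.exp (-(Complex.I * (Real.pi : ℂ) * (k : ℂ) / ((4 : ℝ) : ℂ))) *
          ((Real.cos (k * Real.arccos ξ) : ℝ) : ℂ)) *
        ((besselTerm (2 * (k : ℝ) / 4) (2 / 4 * z ^ ((4 : ℝ) / 2)) n : ℝ) : ℂ) := by
  have hpow : (2 / 4 * z ^ ((4 : ℝ) / 2) / 2) ^ (2 * (n : ℝ) + 2 * (k : ℝ) / 4) =
      (z / 2) ^ (4 * n + k) := by
    rw [show 2 / 4 * z ^ ((4 : ℝ) / 2) / 2 = (z / 2) ^ (2 : ℝ) by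
      rw [show (4 : ℝ) / 2 = 2 by norm_num, Real.rpow_two, Real.rpow_two]; ring,
      ← Real.rpow_mul (by positivity), ← Real.rpow_natCast]
    congr 1
    push_cast
    ring
  have hrho4 : rho ^ 4 = -1 / 16 := by
    rw [show rho ^ 4 = (rho ^ 2) ^ 2 by ring, rho_sq]
    linear_combination (1 / 16 : ℂ) * Complex.I_sq
  rw [planarDouble, besselTerm, hpow, exp_neg_I_pi_mul_div_four, planarSummand, binomGamma]
  have h1 : ((4 * n + k : ℕ) : ℝ) / 2 - n + 1 = n + 2 * (k : ℝ) / 4 + 1 := by push_cast; ring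
  have h2 : ((4 * n + k : ℕ) : ℝ) - 4 * n = k := by push_cast; ring
  have h3 : (rho * (z : ℂ)) ^ (4 * n + k) =
      (-1) ^ n * (2 * rho) ^ k * ((z : ℂ) / 2) ^ (4 * n + k) := by
    rw [pow_add, pow_add, pow_mul, pow_mul, mul_pow rho (z : ℂ) 4, hrho4,
      show ((z : ℂ) / 2) ^ 4 = (z : ℂ) ^ 4 / 16 by ring, mul_assoc ((-1 : ℂ) ^ n),
      mul_left_comm _ ((_ : ℂ) ^ n), ← mul_assoc ((-1 : ℂ) ^ n), ← mul_pow, ← mul_pow]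
    congr 2 <;> ring
  rw [h1, h2, h3]
  push_cast
  rw [mul_inv]
  split_ifs <;> push_cast <;> ring

theorem tsum_planarDouble {z ξ : ℝ} (hz : 0 ≤ z) (k : ℕ) :
    ∑' n, planarDouble (Real.arccos ξ) z (n, k) =
      (if k = 0 then 1 else 2) * planarTerm 4 z ξ k := by
  simp only [planarDouble_eq hz]
  rw [tsum_mul_left, ← Complex.ofReal_tsum, planarTerm, besselJ]
  simp only [besselTerm]
  push_cast
  ring

theorem summable_weighted_planarTerm {z : ℝ} (hz : 0 ≤ z) (ξ : ℝ) :
    Summable fun k : ℕ => (if k = 0 then 1 else 2) * planarTerm 4 z ξ k := by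
  have h := (summable_planarDouble (Real.arccos ξ) z).prod_symm.prod
  simpa only [Prod.swap_prod_mk, tsum_planarDouble hz] using h

theorem summable_planarTerm {z : ℝ} (hz : 0 ≤ z) (ξ : ℝ) :
    Summable fun k : ℕ => planarTerm 4 z ξ (k + 1) := by
  have h := ((summable_nat_add_iff 1).mpr (summable_weighted_planarTerm hz ξ)).mul_left (1 / 2)
  simpa using h

theorem planarKernel_eq_weighted_tsum {z : ℝ} (hz : 0 ≤ z) (ξ : ℝ) :
    planarKernel 4 z ξ = ∑' k : ℕ, (if k = 0 then 1 else 2) * planarTerm 4 z ξ k := by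
  rw [(summable_weighted_planarTerm hz ξ).tsum_eq_zero_add, planarKernel, ← tsum_mul_left]
  simp [planarTerm]

theorem planarKernel_eq_tsum_planarCoeff {z : ℝ} (hz : 0 ≤ z) (ξ : ℝ) :
    planarKernel 4 z ξ = ∑' N : ℕ, (planarCoeff (Real.arccos ξ) N : ℂ) * (rho * z) ^ N := by
  rw [(hasSum_planarCoeff _ z).tsum_eq, planarKernel_eq_weighted_tsum hz,
    ← (Equiv.prodComm ℕ ℕ).tsum_eq, Summable.tsum_prod
      (f := fun p : ℕ × ℕ => planarDouble (Real.arccos ξ) z (Equiv.prodComm ℕ ℕ p))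
      (summable_planarDouble (Real.arccos ξ) z).prod_symm]
  exact tsum_congr fun k => (tsum_planarDouble hz k).symm

/-! ### The differential equation in `z` -/

/-- On the ball of radius $r=|x|+1\ge1$, $n\,r^{n-1}\le(2r)^n$, so the series at $2r$ dominates the
differentiated one. -/
theorem hasDerivAt_tsum_pow {a : ℕ → ℂ} (ha : ∀ x : ℝ, Summable fun n => a n * (x : ℂ) ^ n)
    (x : ℝ) :
    HasDerivAt (fun x : ℝ => ∑' n, a n * (x : ℂ) ^ n)
      (∑' n : ℕ, (n + 1) * a (n + 1) * (x : ℂ) ^ n) x := by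
  set r := |x| + 1 with hr_def
  have hr : 1 ≤ r := by linarith [abs_nonneg x]
  have hu : Summable fun n : ℕ => ‖a n‖ * (2 * r) ^ n := by
    refine (ha (2 * r)).norm.congr fun n => ?_
    rw [norm_mul, norm_pow, Complex.norm_real, Real.norm_of_nonneg (by positivity)]
  have hbound : ∀ n : ℕ, ∀ y ∈ Metric.ball (0 : ℝ) r,
      ‖a n * (n * (y : ℂ) ^ (n - 1))‖ ≤ ‖a n‖ * (2 * r) ^ n := by
    intro n y hy
    rw [mem_ball_zero_iff, Real.norm_eq_abs] at hy
    rw [norm_mul, norm_mul, norm_pow, Complex.norm_real, Real.norm_eq_abs,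
      Complex.norm_natCast, mul_pow]
    gcongr
    · exact_mod_cast Nat.lt_two_pow_self.le
    · calc |y| ^ (n - 1) ≤ r ^ (n - 1) := by gcongr
        _ ≤ r ^ n := pow_le_pow_right₀ hr (by omega)
  have hx : x ∈ Metric.ball (0 : ℝ) r := by
    rw [mem_ball_zero_iff, Real.norm_eq_abs]; linarith
  have hsum : Summable fun n : ℕ => a n * (n * (x : ℂ) ^ (n - 1)) :=
    hu.of_norm_bounded fun n => hbound n x hx
  have hterm : ∀ (n : ℕ) (y : ℝ),
      HasDerivAt (fun y : ℝ => a n * (y : ℂ) ^ n) (a n * (n * (y : ℂ) ^ (n - 1))) y := by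
    intro n y
    simpa using ((Complex.ofRealCLM.hasDerivAt (x := y)).fun_pow n).const_mul (a n)
  have h := hasDerivAt_tsum_of_isPreconnected hu Metric.isOpen_ball
    (convex_ball (0 : ℝ) r).isPreconnected (fun n y _ => hterm n y) hbound hx (ha x) hx
  rw [hsum.tsum_eq_zero_add] at h
  refine h.congr_deriv ?_
  simp only [Nat.cast_zero, zero_mul, mul_zero, zero_add, Nat.add_sub_cancel]
  refine tsum_congr fun n => ?_
  push_cast
  ring

/-- The coefficients of the power series of `exp (i z² / 2)`. -/
def expSqCoeff (N : ℕ) : ℂ :=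
  if Even N then (Complex.I / 2) ^ (N / 2) / (N / 2).factorial else 0

theorem hasSum_expSqCoeff (z : ℝ) :
    HasSum (fun N => expSqCoeff N * (z : ℂ) ^ N) (Complex.exp (Complex.I / 2 * (z : ℂ) ^ 2)) := by
  have h := NormedSpace.expSeries_div_hasSum_exp (Complex.I / 2 * (z : ℂ) ^ 2)
  rw [← Complex.exp_eq_exp_ℂ] at h
  rw [← add_zero (Complex.exp _)]
  refine HasSum.even_add_odd ?_ ?_
  · have he : ∀ j : ℕ, expSqCoeff (2 * j) * (z : ℂ) ^ (2 * j) =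
        (Complex.I / 2 * (z : ℂ) ^ 2) ^ j / j.factorial := fun j => by
      rw [expSqCoeff, if_pos (even_two_mul j), Nat.mul_div_cancel_left j two_pos, mul_pow, ← pow_mul]
      ring
    simpa only [he] using h
  · have h0 : ∀ j : ℕ, expSqCoeff (2 * j + 1) * (z : ℂ) ^ (2 * j + 1) = 0 := fun j => by
      rw [expSqCoeff, if_neg (by simp), zero_mul]
    simpa only [h0] using hasSum_zero

/-- Both parities at once: $\rho^2=-i/4$ turns $4\cos2\theta$ into $-i\cos2\theta$ and
$(-2)^{j+1}\rho^{2j+2}$ into $(i/2)^{j+1}$, a coefficient of $e^{iz^2/2}$. -/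
theorem planarCoeff_recurrence (θ : ℝ) (N : ℕ) :
    (N + 2 : ℂ) * (planarCoeff θ (N + 2) * rho ^ (N + 2)) =
      -Complex.I * (Real.cos (2 * θ) : ℝ) * (planarCoeff θ N * rho ^ N) +
        4 * rho * (Real.cos θ : ℝ) / (√Real.pi : ℝ) * expSqCoeff (N + 1) := by
  obtain ⟨j, rfl | rfl⟩ := Nat.even_or_odd' N
  · have h := congrArg (fun x : ℝ => (x : ℂ)) (planarCoeff_even_recurrence θ j)
    have : expSqCoeff (2 * j + 1) = 0 := if_neg (by simp)
    rw [this, pow_add, rho_sq]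
    push_cast at h ⊢
    linear_combination -rho ^ (2 * j) * Complex.I / 4 * h
  · have h := congrArg (fun x : ℝ => (x : ℂ)) (planarCoeff_odd_recurrence θ j)
    have he : expSqCoeff (2 * j + 1 + 1) = (Complex.I / 2) ^ (j + 1) / (j + 1).factorial := by
      rw [expSqCoeff, if_pos ⟨j + 1, by ring⟩, show (2 * j + 1 + 1) / 2 = j + 1 by omega]
    have hr : rho ^ (2 * j + 3) = (-Complex.I / 4) ^ (j + 1) * rho := by
      rw [← rho_sq]; ring
    have hI : (Complex.I / 2) ^ (j + 1) = (-2) ^ (j + 1) * (-Complex.I / 4) ^ (j + 1) := by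
      rw [← mul_pow]; congr 1; ring
    have hr1 : rho ^ (2 * j + 3) = -Complex.I / 4 * rho ^ (2 * j + 1) := by
      rw [← rho_sq]; ring
    rw [he, hI, show 2 * j + 1 + 2 = 2 * j + 3 by ring]
    push_cast at h ⊢
    linear_combination rho ^ (2 * j + 3) * h +
      4 * Complex.cos (2 * θ) * planarCoeff θ (2 * j + 1) * hr1 +
      4 * Complex.cos θ * ((-2) ^ (j + 1) / ((√Real.pi : ℝ) * (j + 1).factorial)) * hr

theorem planarCoeff_one_mul_rho (θ : ℝ) :
    (planarCoeff θ 1 : ℂ) * rho =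
      4 * rho * (Real.cos θ : ℝ) / (√Real.pi : ℝ) * expSqCoeff 0 := by
  rw [planarCoeff_one]
  simp [expSqCoeff]
  ring

/-! ### The Fresnel integral -/

/-- The complex Fresnel integral `∫₀ˣ exp (i t²) dt`. -/
def fresnel (x : ℝ) : ℂ := ∫ t in (0 : ℝ)..x, Complex.exp (Complex.I * (t : ℂ) ^ 2)

theorem continuous_exp_I_sq : Continuous fun t : ℝ => Complex.exp (Complex.I * (t : ℂ) ^ 2) := by
  fun_prop

theorem hasDerivAt_fresnel (x : ℝ) :
    HasDerivAt fresnel (Complex.exp (Complex.I * (x : ℂ) ^ 2)) x :=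
  (continuous_exp_I_sq.integral_hasStrictDerivAt 0 x).hasDerivAt

theorem fresnel_zero : fresnel 0 = 0 := intervalIntegral.integral_same

theorem integral_exp_I_sq (a b : ℝ) :
    ∫ t in a..b, Complex.exp (Complex.I * (t : ℂ) ^ 2) = fresnel b - fresnel a :=
  (intervalIntegral.integral_interval_sub_left
    (continuous_exp_I_sq.intervalIntegrable _ _) (continuous_exp_I_sq.intervalIntegrable _ _)).symm

theorem fresnel_eq_mul_integral (x : ℝ) :
    fresnel x = x * ∫ s in (0 : ℝ)..1, Complex.exp (Complex.I * ((x : ℂ) * s) ^ 2) := by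
  have h := intervalIntegral.smul_integral_comp_mul_left (a := 0) (b := 1)
    (fun t : ℝ => Complex.exp (Complex.I * (t : ℂ) ^ 2)) x
  simp only [mul_zero, mul_one, Complex.ofReal_mul, Complex.real_smul] at h
  exact h.symm

theorem fresnel_neg (x : ℝ) : fresnel (-x) = -fresnel x := by
  rw [fresnel_eq_mul_integral, fresnel_eq_mul_integral x]
  push_cast
  simp only [neg_mul, neg_sq]

/-- On this line $(2\rho)^2=-i$ makes the Gaussian integrand oscillatory. -/
theorem erf_two_mul_rho_mul (r : ℝ) :
    erf (2 * rho * r) = 4 * rho / (√Real.pi : ℝ) * fresnel r := by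
  have h : ∀ s : ℝ, -((s : ℂ) * (2 * rho * r)) ^ 2 = Complex.I * ((r : ℂ) * s) ^ 2 := fun s => by
    linear_combination -4 * (s : ℂ) ^ 2 * r ^ 2 * rho_sq
  rw [erf, fresnel_eq_mul_integral]
  simp only [h, intervalIntegral.integral_mul_const]
  ring

/-- An auxiliary integral whose derivative is that of `I * fresnel ^ 2`. -/
def fresnelAux (x : ℝ) : ℂ :=
  ∫ t in (0 : ℝ)..1, Complex.exp (Complex.I * (x : ℂ) ^ 2 * (1 + (t : ℂ) ^ 2)) * ((1 + t ^ 2)⁻¹ : ℝ)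

theorem continuous_inv_one_add_sq : Continuous fun t : ℝ => (1 + t ^ 2)⁻¹ :=
  Continuous.inv₀ (by fun_prop) fun t => by positivity

theorem norm_exp_I_mul_ofReal_sq (x y : ℝ) :
    ‖Complex.exp (Complex.I * (x : ℂ) ^ 2 * (1 + (y : ℂ) ^ 2))‖ = 1 := by
  rw [show Complex.I * (x : ℂ) ^ 2 * (1 + (y : ℂ) ^ 2) =
    ((x ^ 2 * (1 + y ^ 2) : ℝ) : ℂ) * Complex.I by push_cast; ring]
  exact Complex.norm_exp_ofReal_mul_I _

theorem hasDerivAt_fresnelAux (x : ℝ) :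
    HasDerivAt fresnelAux (2 * Complex.I * Complex.exp (Complex.I * (x : ℂ) ^ 2) * fresnel x) x := by
  have hF : ∀ x t : ℝ, HasDerivAt (fun x : ℝ =>
      Complex.exp (Complex.I * (x : ℂ) ^ 2 * (1 + (t : ℂ) ^ 2)) * ((1 + t ^ 2)⁻¹ : ℝ))
      (2 * Complex.I * x * Complex.exp (Complex.I * (x : ℂ) ^ 2 * (1 + (t : ℂ) ^ 2))) x := by
    intro x t
    have h1 : HasDerivAt (fun x : ℝ => Complex.I * (x : ℂ) ^ 2 * (1 + (t : ℂ) ^ 2))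
        (Complex.I * (2 * x) * (1 + (t : ℂ) ^ 2)) x := by
      simpa using
        (((Complex.ofRealCLM.hasDerivAt (x := x)).fun_pow 2).const_mul Complex.I).mul_const
          (1 + (t : ℂ) ^ 2)
    refine (h1.cexp.mul_const _).congr_deriv ?_
    have ht : (1 + (t : ℂ) ^ 2) ≠ 0 := by
      have : (1 + t ^ 2 : ℝ) ≠ 0 := by positivity
      exact_mod_cast this
    push_cast
    field_simp
  have hcF : ∀ x : ℝ, Continuous fun t : ℝ =>
      Complex.exp (Complex.I * (x : ℂ) ^ 2 * (1 + (t : ℂ) ^ 2)) * ((1 + t ^ 2)⁻¹ : ℝ) := fun x =>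
    Continuous.mul (by fun_prop) (Complex.continuous_ofReal.comp continuous_inv_one_add_sq)
  have hcF' : ∀ x : ℝ, Continuous fun t : ℝ =>
      2 * Complex.I * x * Complex.exp (Complex.I * (x : ℂ) ^ 2 * (1 + (t : ℂ) ^ 2)) := fun x => by
    fun_prop
  have h := (intervalIntegral.hasDerivAt_integral_of_dominated_loc_of_deriv_le
    (μ := MeasureTheory.volume) (a := 0) (b := 1) (bound := fun _ => 2 * (|x| + 1))
    (Metric.ball_mem_nhds x one_pos)
    (Eventually.of_forall fun y => (hcF y).aestronglyMeasurable)
    ((hcF x).intervalIntegrable 0 1) (hcF' x).aestronglyMeasurable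
    (Eventually.of_forall fun t _ y hy => by
      rw [norm_mul, norm_exp_I_mul_ofReal_sq, norm_mul, norm_mul, Complex.norm_I,
        Complex.norm_real, Complex.norm_two, mul_one, mul_one, Real.norm_eq_abs]
      have hy' : |y - x| < 1 := by simpa [Real.dist_eq] using hy
      have := abs_sub_abs_le_abs_sub y x
      linarith)
    intervalIntegrable_const (Eventually.of_forall fun t _ y _ => hF y t)).2
  refine h.congr_deriv ?_
  rw [fresnel_eq_mul_integral, ← mul_assoc, ← intervalIntegral.integral_const_mul]
  refine intervalIntegral.integral_congr fun t _ => ?_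
  rw [show Complex.I * (x : ℂ) ^ 2 * (1 + (t : ℂ) ^ 2) =
    Complex.I * (x : ℂ) ^ 2 + Complex.I * ((x : ℂ) * t) ^ 2 by ring, Complex.exp_add]
  ring

/-- The classical device for the Gaussian integral: both sides have the same derivative, and
`fresnelAux` at $0$ is $\arctan 1$. -/
theorem fresnel_sq (x : ℝ) : Complex.I * fresnel x ^ 2 = fresnelAux x - Real.pi / 4 := by
  have hd : ∀ x, HasDerivAt (fun x => Complex.I * fresnel x ^ 2 - fresnelAux x) 0 x := fun x => by
    refine ((((hasDerivAt_fresnel x).fun_pow 2).const_mul Complex.I).sub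
      (hasDerivAt_fresnelAux x)).congr_deriv ?_
    push_cast
    ring
  have h := is_const_of_deriv_eq_zero (fun x => (hd x).differentiableAt) (fun x => (hd x).deriv) x 0
  have h0 : fresnelAux 0 = Real.pi / 4 := by
    have : ∫ t in (0 : ℝ)..1, (((1 + t ^ 2)⁻¹ : ℝ) : ℂ) = ((Real.pi / 4 : ℝ) : ℂ) := by
      rw [intervalIntegral.integral_ofReal, integral_inv_one_add_sq]
      simp
    simpa [fresnelAux] using this
  rw [fresnel_zero, h0] at h
  linear_combination h

/-- `fresnel_sq` gives $|F|^2\le\pi/2$; the weaker bound $2$ is what the constant $2\sqrt{2/\pi}$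
requires. -/
theorem norm_fresnel_le (x : ℝ) : ‖fresnel x‖ ≤ √2 := by
  have hA : ‖fresnelAux x‖ ≤ Real.pi / 4 := by
    calc ‖fresnelAux x‖ ≤ ∫ t in (0 : ℝ)..1, (1 + t ^ 2)⁻¹ := by
          refine intervalIntegral.norm_integral_le_of_norm_le zero_le_one
            (Eventually.of_forall fun t _ => ?_) (continuous_inv_one_add_sq.intervalIntegrable 0 1)
          rw [norm_mul, norm_exp_I_mul_ofReal_sq, one_mul, Complex.norm_real,
            Real.norm_of_nonneg (by positivity)]
      _ = Real.pi / 4 := by rw [integral_inv_one_add_sq]; simp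
  have h : ‖fresnel x‖ ^ 2 ≤ 2 := by
    calc ‖fresnel x‖ ^ 2 = ‖Complex.I * fresnel x ^ 2‖ := by simp
      _ ≤ ‖fresnelAux x‖ + ‖((Real.pi / 4 : ℝ) : ℂ)‖ := by
          rw [fresnel_sq]
          push_cast
          exact norm_sub_le _ _
      _ ≤ Real.pi / 4 + Real.pi / 4 := by
          rw [Complex.norm_real, Real.norm_of_nonneg (by positivity)]
          gcongr
      _ ≤ 2 := by linarith [Real.pi_le_four]
  exact Real.le_sqrt_of_sq_le h

theorem norm_exp_neg_mul_sq_le {b : ℂ} (hb : 0 ≤ b.re) (t : ℝ) :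
    ‖Complex.exp (-b * (t : ℂ) ^ 2)‖ ≤ 1 := by
  rw [Complex.norm_exp, Real.exp_le_one_iff, ← Complex.ofReal_pow, Complex.re_mul_ofReal,
    Complex.neg_re]
  nlinarith [sq_nonneg t, mul_nonneg hb (sq_nonneg t)]

/-- Integration by parts with $-e^{-bt^2}/(2bt)$. In the sum of the bounds the terms in $s$ cancel,
so the estimate is uniform in $s$ and survives $\operatorname{Re}b\to0$. -/
theorem norm_integral_exp_neg_mul_sq_le {b : ℂ} (hb : 0 ≤ b.re) (hb0 : b ≠ 0) {w s : ℝ}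
    (hw : 0 < w) (hws : w ≤ s) :
    ‖∫ t in w..s, Complex.exp (-b * (t : ℂ) ^ 2)‖ ≤ 1 / (‖b‖ * w) := by
  have hs : 0 < s := hw.trans_le hws
  have hbn : 0 < ‖b‖ := norm_pos_iff.mpr hb0
  have hpos : ∀ t ∈ Set.uIcc w s, 0 < t := fun t ht => by
    rw [Set.uIcc_of_le hws] at ht
    exact hw.trans_le ht.1
  set e : ℝ → ℂ := fun t => Complex.exp (-b * (t : ℂ) ^ 2)
  have hec : Continuous e := by fun_prop
  have hrc : ContinuousOn (fun t : ℝ => e t / (2 * b * (t : ℂ) ^ 2)) (Set.uIcc w s) := by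
    refine hec.continuousOn.div (by fun_prop) fun t ht => ?_
    have : (t : ℂ) ≠ 0 := by exact_mod_cast (hpos t ht).ne'
    exact mul_ne_zero (mul_ne_zero two_ne_zero hb0) (pow_ne_zero 2 this)
  have hG : ∀ t ∈ Set.uIcc w s, HasDerivAt (fun t : ℝ => -e t / (2 * b * t))
      (e t + e t / (2 * b * (t : ℂ) ^ 2)) t := by
    intro t ht
    have ht0 : (t : ℂ) ≠ 0 := by exact_mod_cast (hpos t ht).ne'
    have h1 : HasDerivAt (fun t : ℝ => -b * (t : ℂ) ^ 2) (-b * (2 * t)) t := by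
      simpa using ((Complex.ofRealCLM.hasDerivAt (x := t)).fun_pow 2).const_mul (-b)
    have h2 : HasDerivAt (fun t : ℝ => 2 * b * (t : ℂ)) (2 * b) t := by
      simpa using (Complex.ofRealCLM.hasDerivAt (x := t)).const_mul (2 * b)
    refine (h1.cexp.fun_neg.fun_div h2 (by simp [hb0, ht0])).congr_deriv ?_
    simp only [e]
    field_simp
    ring
  have hFTC := intervalIntegral.integral_eq_sub_of_hasDerivAt hG
    ((hec.continuousOn.add hrc).intervalIntegrable)
  rw [intervalIntegral.integral_add (hec.intervalIntegrable _ _) hrc.intervalIntegrable] at hFTC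
  have hB : ∀ t ∈ Set.uIcc w s, HasDerivAt (fun t : ℝ => -(1 / (2 * ‖b‖ * t)))
      (1 / (2 * ‖b‖ * t ^ 2)) t := by
    intro t ht
    have ht0 := (hpos t ht).ne'
    have h2 : HasDerivAt (fun t : ℝ => 2 * ‖b‖ * t) (2 * ‖b‖) t := by
      simpa using (hasDerivAt_id t).const_mul (2 * ‖b‖)
    refine ((hasDerivAt_const t (1 : ℝ)).fun_div h2 (by positivity)).fun_neg.congr_deriv ?_
    field_simp
    ring
  have hBc : ContinuousOn (fun t : ℝ => 1 / (2 * ‖b‖ * t ^ 2)) (Set.uIcc w s) :=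
    continuousOn_const.div (by fun_prop) fun t ht => by
      have := hpos t ht
      positivity
  have hBint := intervalIntegral.integral_eq_sub_of_hasDerivAt hB hBc.intervalIntegrable
  have hrem : ‖∫ t in w..s, e t / (2 * b * (t : ℂ) ^ 2)‖ ≤
      -(1 / (2 * ‖b‖ * s)) - -(1 / (2 * ‖b‖ * w)) := by
    rw [← hBint]
    refine intervalIntegral.norm_integral_le_of_norm_le hws (Eventually.of_forall fun t ht => ?_)
      hBc.intervalIntegrable
    have ht0 : 0 < t := hw.trans ht.1
    rw [norm_div, norm_mul, norm_mul, norm_pow, Complex.norm_real, Complex.norm_two,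
      Real.norm_of_nonneg ht0.le]
    gcongr
    exact norm_exp_neg_mul_sq_le hb t
  have hbd : ∀ t : ℝ, 0 < t → ‖-e t / (2 * b * t)‖ ≤ 1 / (2 * ‖b‖ * t) := fun t ht => by
    rw [norm_div, norm_neg, norm_mul, norm_mul, Complex.norm_real, Complex.norm_two,
      Real.norm_of_nonneg ht.le]
    gcongr
    exact norm_exp_neg_mul_sq_le hb t
  rw [eq_sub_of_add_eq hFTC]
  calc _ ≤ ‖-e s / (2 * b * s)‖ + ‖-e w / (2 * b * w)‖ + ‖∫ t in w..s, e t / (2 * b * (t : ℂ) ^ 2)‖ :=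
        (norm_sub_le _ _).trans (add_le_add_left (norm_sub_le _ _) _)
    _ ≤ 1 / (2 * ‖b‖ * s) + 1 / (2 * ‖b‖ * w) + (-(1 / (2 * ‖b‖ * s)) - -(1 / (2 * ‖b‖ * w))) :=
        add_le_add (add_le_add (hbd s hs) (hbd w hw)) hrem
    _ = 1 / (‖b‖ * w) := by field_simp; ring

theorem norm_gaussian_sub_integral_le {b : ℂ} (hb : 0 < b.re) {w : ℝ} (hw : 0 < w) :
    ‖(Real.pi / b) ^ (1 / 2 : ℂ) / 2 - ∫ t in (0 : ℝ)..w, Complex.exp (-b * (t : ℂ) ^ 2)‖ ≤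
      1 / (‖b‖ * w) := by
  have hb0 : b ≠ 0 := by rintro rfl; simp at hb
  have hc : Continuous fun t : ℝ => Complex.exp (-b * (t : ℂ) ^ 2) := by fun_prop
  have hlim := MeasureTheory.intervalIntegral_tendsto_integral_Ioi 0
    (integrable_cexp_neg_mul_sq hb).integrableOn tendsto_id
  rw [integral_gaussian_complex_Ioi hb] at hlim
  refine le_of_tendsto (hlim.sub_const _).norm ?_
  filter_upwards [eventually_ge_atTop w] with s hs
  rw [id, intervalIntegral.integral_interval_sub_left (hc.intervalIntegrable _ _)
    (hc.intervalIntegrable _ _)]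
  exact norm_integral_exp_neg_mul_sq_le hb.le hb0 hw hs

/-- The limit of the Fresnel integral at infinity. -/
def fresnelLimit : ℂ := (√Real.pi : ℝ) / 2 * ((1 + Complex.I) * (√2 / 2 : ℝ))

/-- The principal square root of $i\pi$ is the one with positive real part. -/
theorem gaussian_at_neg_I : ((Real.pi : ℂ) / -Complex.I) ^ (1 / 2 : ℂ) / 2 = fresnelLimit := by
  have hsq : (Real.pi : ℂ) / -Complex.I =
      ((√Real.pi : ℝ) * ((1 + Complex.I) * (√2 / 2 : ℝ))) ^ 2 := by
    rw [mul_pow, mul_pow, ← Complex.ofReal_pow, ← Complex.ofReal_pow, div_pow,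
      Real.sq_sqrt two_pos.le, Real.sq_sqrt Real.pi_pos.le, div_neg, Complex.div_I]
    push_cast
    linear_combination -(Real.pi / 2 : ℂ) * Complex.I_sq
  rw [hsq, one_div, Complex.sq_cpow_two_inv, fresnelLimit]
  · ring
  · rw [Complex.re_ofReal_mul, Complex.re_mul_ofReal]
    simp only [Complex.add_re, Complex.one_re, Complex.I_re]
    positivity

/-- Apply the Gaussian tail bound at $b=\varepsilon-i$ and let $\varepsilon\to0^+$ with $w$ fixed.
The square root is continuous there because $i\pi$ lies off the branch cut. -/
theorem norm_fresnelLimit_sub_fresnel_le {w : ℝ} (hw : 0 < w) :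
    ‖fresnelLimit - fresnel w‖ ≤ 1 / w := by
  have hb : Continuous fun ε : ℝ => (ε : ℂ) - Complex.I := by fun_prop
  have hint : Continuous fun ε : ℝ =>
      ∫ t in (0 : ℝ)..w, Complex.exp (-((ε : ℂ) - Complex.I) * (t : ℂ) ^ 2) :=
    intervalIntegral.continuous_parametric_intervalIntegral_of_continuous' (by fun_prop) _ _
  have hcpow : ContinuousAt (fun ε : ℝ =>
      ((Real.pi : ℂ) / ((ε : ℂ) - Complex.I)) ^ (1 / 2 : ℂ) / 2) 0 := by
    refine ((continuousAt_const.div hb.continuousAt (by simp)).cpow continuousAt_const ?_).div_const _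
    refine Complex.mem_slitPlane_iff.mpr (Or.inr ?_)
    rw [Pi.div_apply, Complex.ofReal_zero, zero_sub, div_neg, Complex.div_I]
    simp
  have hnorm : ContinuousAt (fun ε : ℝ => 1 / (‖(ε : ℂ) - Complex.I‖ * w)) 0 :=
    continuousAt_const.div (by fun_prop) (by simp [hw.ne'])
  have h := le_of_tendsto_of_tendsto
    ((hcpow.sub hint.continuousAt).norm.tendsto.mono_left (nhdsWithin_le_nhds (s := Set.Ioi 0)))
    (hnorm.tendsto.mono_left nhdsWithin_le_nhds) (by
      filter_upwards [self_mem_nhdsWithin] with ε hε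
      exact norm_gaussian_sub_integral_le (by simpa using hε) hw)
  rw [← gaussian_at_neg_I]
  simpa [fresnel] using h

theorem tendsto_fresnel_atTop : Tendsto fresnel atTop (𝓝 fresnelLimit) := by
  rw [tendsto_iff_norm_sub_tendsto_zero]
  refine squeeze_zero' (Eventually.of_forall fun _ => norm_nonneg _) ?_
    (tendsto_const_nhds.div_atTop tendsto_id : Tendsto (fun w : ℝ => 1 / w) atTop (𝓝 0))
  filter_upwards [eventually_gt_atTop 0] with w hw
  rw [norm_sub_rev]
  exact norm_fresnelLimit_sub_fresnel_le hw

theorem tendsto_fresnel_atBot : Tendsto fresnel atBot (𝓝 (-fresnelLimit)) := by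
  have h := (tendsto_fresnel_atTop.comp tendsto_neg_atBot_atTop).neg
  refine h.congr fun x => ?_
  simp [fresnel_neg]

/-! ### The closed form of the planar kernel -/

theorem four_mul_rho_div_sqrt_pi :
    4 * rho / (√Real.pi : ℝ) = (1 - Complex.I) * (√(2 / Real.pi) : ℝ) := by
  have h : (√2 : ℝ) / √Real.pi = √(2 / Real.pi) := (Real.sqrt_div two_pos.le _).symm
  rw [← h]
  have := two_mul_rho
  push_cast at this ⊢
  linear_combination (2 / (√Real.pi : ℂ)) * this

theorem four_mul_rho_div_sqrt_pi_mul_fresnelLimit :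
    4 * rho / (√Real.pi : ℝ) * fresnelLimit = 1 := by
  have h2 : ((√2 : ℝ) : ℂ) ^ 2 = 2 := by
    rw [← Complex.ofReal_pow, Real.sq_sqrt two_pos.le]; simp
  have hpi : ((√Real.pi : ℝ) : ℂ) ≠ 0 := by
    exact_mod_cast (Real.sqrt_pos.mpr Real.pi_pos).ne'
  have := two_mul_rho
  rw [fresnelLimit, show 4 * rho = 2 * (2 * rho) by ring, this]
  push_cast
  field_simp
  linear_combination (1 - Complex.I ^ 2) * h2 - 2 * Complex.I_sq

theorem summable_planarCoeff (θ z : ℝ) :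
    Summable fun N : ℕ => ((planarCoeff θ N : ℂ) * rho ^ N) * (z : ℂ) ^ N :=
  (hasSum_planarCoeff θ z).summable.congr fun N => by rw [mul_pow]; ring

theorem hasDerivAt_planarSeries (θ z : ℝ) :
    HasDerivAt (fun z : ℝ => ∑' N : ℕ, ((planarCoeff θ N : ℂ) * rho ^ N) * (z : ℂ) ^ N)
      (-Complex.I * (Real.cos (2 * θ) : ℝ) * z *
          ∑' N : ℕ, ((planarCoeff θ N : ℂ) * rho ^ N) * (z : ℂ) ^ N +
        4 * rho * (Real.cos θ : ℝ) / (√Real.pi : ℝ) *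
          Complex.exp (Complex.I / 2 * (z : ℂ) ^ 2)) z := by
  refine (hasDerivAt_tsum_pow (summable_planarCoeff θ) z).congr_deriv ?_
  have hS := (summable_planarCoeff θ z).hasSum.mul_left
    (-Complex.I * (Real.cos (2 * θ) : ℝ) * z)
  have hE := (hasSum_expSqCoeff z).mul_left (4 * rho * (Real.cos θ : ℝ) / (√Real.pi : ℝ))
  -- The factor $z$ raises every degree by one, so the shifted series has coefficient $0$ in degree
  -- $0$.
  have hshift : HasSum (fun N : ℕ => (Nat.casesOn N 0 fun N =>
      -Complex.I * (Real.cos (2 * θ) : ℝ) * z *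
        (((planarCoeff θ N : ℂ) * rho ^ N) * (z : ℂ) ^ N) : ℂ)) _ :=
    (hasSum_nat_add_iff 1).mp hS
  rw [Finset.sum_range_one] at hshift
  change HasSum _ (_ + 0) at hshift
  rw [add_zero] at hshift
  rw [← (hshift.add hE).tsum_eq]
  refine tsum_congr ?_
  rintro (_ | N)
  · have := planarCoeff_one_mul_rho θ
    simp only [pow_one, zero_add, Nat.cast_zero, pow_zero, mul_one, one_mul]
    exact this.trans (zero_add _).symm
  · have := planarCoeff_recurrence θ N
    simp only
    push_cast at this ⊢
    linear_combination (z : ℂ) ^ (N + 1) * this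

theorem planarSeries_eq (θ z : ℝ) :
    ∑' N : ℕ, ((planarCoeff θ N : ℂ) * rho ^ N) * (z : ℂ) ^ N =
      Complex.exp (-(Complex.I / 2 * (z : ℂ) ^ 2 * (Real.cos (2 * θ) : ℝ))) *
        (1 + 4 * rho / (√Real.pi : ℝ) * fresnel (z * Real.cos θ)) := by
  set H : ℝ → ℂ := fun z => ∑' N : ℕ, ((planarCoeff θ N : ℂ) * rho ^ N) * (z : ℂ) ^ N with hH
  set E : ℝ → ℂ := fun z =>
    Complex.exp (Complex.I / 2 * (z : ℂ) ^ 2 * (Real.cos (2 * θ) : ℝ)) * H z -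
      4 * rho / (√Real.pi : ℝ) * fresnel (z * Real.cos θ) with hE
  have hd : ∀ z, HasDerivAt E 0 z := by
    intro z
    have h1 : HasDerivAt (fun z : ℝ => Complex.I / 2 * (z : ℂ) ^ 2 * (Real.cos (2 * θ) : ℝ))
        (Complex.I / 2 * (2 * z) * (Real.cos (2 * θ) : ℝ)) z := by
      simpa using
        (((Complex.ofRealCLM.hasDerivAt (x := z)).fun_pow 2).const_mul (Complex.I / 2)).mul_const
          ((Real.cos (2 * θ) : ℝ) : ℂ)
    have h2 : HasDerivAt (fun z : ℝ => fresnel (z * Real.cos θ))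
        (Real.cos θ • Complex.exp (Complex.I * ((z * Real.cos θ : ℝ) : ℂ) ^ 2)) z := by
      have h3 : HasDerivAt (fun z : ℝ => z * Real.cos θ) (Real.cos θ) z := by
        simpa using (hasDerivAt_id z).mul_const (Real.cos θ)
      exact (hasDerivAt_fresnel (z * Real.cos θ)).scomp z h3
    refine ((h1.cexp.mul (hasDerivAt_planarSeries θ z)).sub
      (h2.const_mul (4 * rho / (√Real.pi : ℝ)))).congr_deriv ?_
    -- By $1+\cos2\theta=2\cos^2\theta$, the integrating factor times the forcing term is the
    -- Fresnel integrand at $z\cos\theta$.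
    have hexp : Complex.exp (Complex.I * ((z * Real.cos θ : ℝ) : ℂ) ^ 2) =
        Complex.exp (Complex.I / 2 * (z : ℂ) ^ 2 * (Real.cos (2 * θ) : ℝ)) *
          Complex.exp (Complex.I / 2 * (z : ℂ) ^ 2) := by
      rw [← Complex.exp_add, Real.cos_two_mul]
      congr 1
      push_cast
      ring
    rw [hexp, Complex.real_smul]
    ring
  have hconst := is_const_of_deriv_eq_zero (fun z => (hd z).differentiableAt)
    (fun z => (hd z).deriv) z 0
  have hH0 : H 0 = 1 := by
    rw [hH]
    beta_reduce
    rw [tsum_eq_single 0 fun N hN => by simp [hN]]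
    simp [planarCoeff_zero]
  have hE0 : E 0 = 1 := by
    simp [hE, hH0, fresnel_zero]
  rw [hE0, hE, sub_eq_iff_eq_add] at hconst
  rw [← hconst, ← mul_assoc, ← Complex.exp_add]
  simp [hH]

theorem planarKernel_eq {z : ℝ} (hz : 0 ≤ z) {ξ : ℝ} (hξ : ξ ∈ Set.Icc (-1 : ℝ) 1) :
    planarKernel 4 z ξ =
      Complex.exp (-(Complex.I / 2 * (z : ℂ) ^ 2 * ((2 * ξ ^ 2 - 1 : ℝ) : ℂ))) *
        (1 + 4 * rho / (√Real.pi : ℝ) * fresnel (z * ξ)) := by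
  have h := planarSeries_eq (Real.arccos ξ) z
  rw [Real.cos_two_mul, Real.cos_arccos hξ.1 hξ.2] at h
  rw [planarKernel_eq_tsum_planarCoeff hz, ← h]
  refine tsum_congr fun N => ?_
  rw [mul_pow]
  ring

theorem planarKernel_eq_erfc {z : ℝ} (hz : 0 ≤ z) {ξ : ℝ} (hξ : ξ ∈ Set.Icc (-1 : ℝ) 1) :
    planarKernel 4 z ξ =
      Complex.exp (-(Complex.I * (z : ℂ) ^ 2 * ((ξ : ℂ) ^ 2 - 1 / 2))) *
        erfc (-(Complex.exp (-(Complex.I * ((Real.pi : ℂ) / 4))) * (z : ℂ) * (ξ : ℂ))) := by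
  have h : -(Complex.exp (-(Complex.I * ((Real.pi : ℂ) / 4))) * (z : ℂ) * (ξ : ℂ)) =
      2 * rho * ((-(z * ξ) : ℝ) : ℂ) := by
    rw [rho]
    push_cast
    ring
  rw [planarKernel_eq hz hξ, h, erfc, erf_two_mul_rho_mul, fresnel_neg]
  congr 2
  · push_cast
    ring
  · ring

theorem norm_exp_neg_I_div_two_mul (z c : ℝ) :
    ‖Complex.exp (-(Complex.I / 2 * (z : ℂ) ^ 2 * (c : ℂ)))‖ = 1 := by
  rw [show -(Complex.I / 2 * (z : ℂ) ^ 2 * (c : ℂ)) = ((-(z ^ 2 * c / 2) : ℝ) : ℂ) * Complex.I by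
    push_cast; ring]
  exact Complex.norm_exp_ofReal_mul_I _

theorem norm_four_mul_rho_div_sqrt_pi : ‖4 * rho / (√Real.pi : ℝ)‖ = 2 / √Real.pi := by
  rw [norm_div, norm_mul, norm_rho, Complex.norm_real, Real.norm_of_nonneg (Real.sqrt_nonneg _)]
  norm_num

theorem norm_planarKernel_le {z : ℝ} (hz : 0 ≤ z) {ξ : ℝ} (hξ : ξ ∈ Set.Icc (-1 : ℝ) 1) :
    ‖planarKernel 4 z ξ‖ ≤ 1 + 2 * √(2 / Real.pi) := by
  rw [planarKernel_eq hz hξ, norm_mul, norm_exp_neg_I_div_two_mul, one_mul]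
  refine (norm_add_le _ _).trans ?_
  rw [norm_one, norm_mul, norm_four_mul_rho_div_sqrt_pi, Real.sqrt_div two_pos.le,
    show 2 * (√2 / √Real.pi) = 2 / √Real.pi * √2 by ring]
  gcongr
  exact norm_fresnel_le _

theorem tendsto_norm_planarKernel_one :
    Tendsto (fun z : ℝ => ‖planarKernel 4 z 1‖) atTop (𝓝 2) := by
  have h := ((tendsto_fresnel_atTop.const_mul (4 * rho / (√Real.pi : ℝ))).const_add 1).norm
  rw [four_mul_rho_div_sqrt_pi_mul_fresnelLimit, show ‖(1 + 1 : ℂ)‖ = 2 by norm_num] at h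
  refine h.congr' ?_
  filter_upwards [eventually_ge_atTop 0] with z hz
  rw [planarKernel_eq hz (by norm_num), norm_mul, norm_exp_neg_I_div_two_mul, one_mul, mul_one]

theorem tendsto_integral_exp_I_sq_atBot (x : ℝ) :
    Tendsto (fun s : ℝ => ∫ t in s..x, Complex.exp (Complex.I * (t : ℂ) ^ 2)) atBot
      (𝓝 (fresnel x + fresnelLimit)) := by
  simpa only [integral_exp_I_sq, sub_neg_eq_add] using tendsto_fresnel_atBot.const_sub (fresnel x)

/-- The summand $1$ is $\frac{4\rho}{\sqrt\pi}$ times the integral over $(-\infty,0]$, which moves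
the lower limit to $-\infty$. -/
theorem planarKernel_eq_fresnel {z : ℝ} (hz : 0 ≤ z) (θ : ℝ) :
    planarKernel 4 z (Real.cos θ) =
      (1 - Complex.I) * (√(2 / Real.pi) : ℂ) *
        Complex.exp (-(Complex.I / 2 * (z : ℂ) ^ 2 * (Real.cos (2 * θ) : ℂ))) *
          (fresnel (z * Real.cos θ) + fresnelLimit) := by
  rw [planarKernel_eq hz (Real.cos_mem_Icc θ), ← four_mul_rho_div_sqrt_pi, ← Real.cos_two_mul]
  linear_combination
    -Complex.exp (-(Complex.I / 2 * (z : ℂ) ^ 2 * (Real.cos (2 * θ) : ℂ))) *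
      four_mul_rho_div_sqrt_pi_mul_fresnelLimit

end RadialFourier

end

theorem mainTheorem5 :
    -- the two-dimensional series converges and is the limit `l → 0` of the general kernel
    (∀ z : ℝ, 0 ≤ z → ∀ ξ ∈ Set.Icc (-1 : ℝ) 1,
      Summable (fun k : ℕ => RadialFourier.planarTerm 4 z ξ (k + 1))) ∧
    (∀ z : ℝ, 0 < z → ∀ ξ ∈ Set.Icc (-1 : ℝ) 1,
      (∀ᶠ l : ℝ in 𝓝[≠] 0, Summable (RadialFourier.kernelTerm 4 l z ξ)) ∧
      Tendsto (fun l : ℝ => RadialFourier.kernel 4 l z ξ) (𝓝[≠] 0)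
        (𝓝 (RadialFourier.planarKernel 4 z ξ))) ∧
    -- the two closed forms; the Fresnel-type integral is an improper one
    (∀ z : ℝ, 0 ≤ z → ∀ ξ θ : ℝ, ξ = Real.cos θ →
      RadialFourier.planarKernel 4 z ξ =
        Complex.exp (-(Complex.I * (z : ℂ) ^ 2 * ((ξ : ℂ) ^ 2 - 1 / 2))) *
          RadialFourier.erfc
            (-(Complex.exp (-(Complex.I * ((Real.pi : ℂ) / 4))) * (z : ℂ) * (ξ : ℂ))) ∧
      ∃ L : ℂ,
        Tendsto (fun s : ℝ => ∫ t in s..(z * Real.cos θ), Complex.exp (Complex.I * (t : ℂ) ^ 2))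
          atBot (𝓝 L) ∧
        RadialFourier.planarKernel 4 z ξ =
          (1 - Complex.I) * (Real.sqrt (2 / Real.pi) : ℂ) *
            Complex.exp (-(Complex.I / 2 * (z : ℂ) ^ 2 * (Real.cos (2 * θ) : ℂ))) * L) ∧
    -- the uniform bound
    (∀ z : ℝ, 0 ≤ z → ∀ ξ ∈ Set.Icc (-1 : ℝ) 1,
      ‖RadialFourier.planarKernel 4 z ξ‖ ≤ 1 + 2 * Real.sqrt (2 / Real.pi)) ∧
    -- the limit at `ξ = 1`
    Tendsto (fun z : ℝ => ‖RadialFourier.planarKernel 4 z 1‖) atTop (𝓝 2) := by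
  refine ⟨fun z hz ξ _ => RadialFourier.summable_planarTerm hz ξ,
    fun z hz ξ hξ => ⟨RadialFourier.eventually_summable_kernelTerm hz hξ,
      RadialFourier.tendsto_kernel hz hξ (RadialFourier.summable_planarTerm hz.le ξ)⟩,
    ?_, fun z hz ξ hξ => RadialFourier.norm_planarKernel_le hz hξ,
    RadialFourier.tendsto_norm_planarKernel_one⟩
  rintro z hz ξ θ rfl
  exact ⟨RadialFourier.planarKernel_eq_erfc hz (Real.cos_mem_Icc θ), _,
    RadialFourier.tendsto_integral_exp_I_sq_atBot _, RadialFourier.planarKernel_eq_fresnel hz θ⟩
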